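/- For $x\in\{0,1\}^N$ write $\|x\|=\sum_k x[k]$, and write $\bar a=1-a$. For parameters $\varphi,\gamma\in(0,1)$ with $\varphi+\gamma\ge 1$ and $\alpha=\min\{\varphi,\gamma\}$ put, for $x,y,z\in\{0,1\}^N$, $$p_z(x,y)=\varphi^{\|y\|}\bar\varphi^{\,N-\|y\|}\prod_{k=1}^N\Big\{1+\frac{\alpha}{\bar\alpha}\Big(1-\frac{z[k]}{\alpha}\Big)\Big(1-\frac{y[k]}{\varphi}\Big)\Big(1-\frac{x[k]}{\gamma}\Big)\Big\},$$ which is a transition probability on $\{0,1\}^N$ for each $z$. A time-homogeneous long-range random walk with exchangeable coordinates, with parameters $\varphi,\gamma$, is a process $(X_t)_{t\ge0}$ in $\{0,1\}^N$ driven by random vectors $(Z_t)_{t\ge1}$ in $\{0,1\}^N$ such that, for every $t\ge1$, $Z_t$ is independent of $(X_s,Z_s)_{s<t}$, its law $\zeta$ does not depend on $t$ and is invariant under permutations of the coordinates, and, given the past $(X_s,Z_s)_{s<t}$ and $Z_t=z$, the law of $X_t$ is $p_z(X_{t-1},\cdot)$. The law of $X_0$ is arbitrary. For each $N$ let $(X_t^{(N)}),(Z_t^{(N)})$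 be such a walk with parameters $\varphi^{(N)},\gamma^{(N)}$, where $\alpha=\min\{\varphi^{(N)},\gamma^{(N)}\}$ does not depend on $N$ and $N^{1/2}(\varphi^{(N)}-\gamma^{(N)})\to c\in\mathbb R$. Put $\varphi:=\alpha=\lim_N\varphi^{(N)}$. Assume that $\|Z_t^{(N)}\|/N$ converges in distribution to a probability measure $\nu$ on $[0,1]$, and, with $V_t^{(N)}=N^{-1/2}(\|X_t^{(N)}\|-N\varphi^{(N)})$, that $V_0^{(N)}$ converges in distribution to a probability measure $\mu_0$ on $\mathbb R$. Then there are random variables $V_t$ ($t\ge 0$), $\Theta_t,\varepsilon_t$ ($t\ge1$) on a common probability space such that the following hold. 1. (AR(1) series with random coefficients.) $V_0\sim\mu_0$; the pairs $(\Theta_t,\varepsilon_t)$, $t\ge1$, are independent of each other and (jointly) of $V_0$; $\Theta_t\sim\nu$; conditionally on $\Theta_t$, $\varepsilon_t$ is normal with mean $0$ and variance $\varphi\bar\varphi\big(1-(1-\Theta_t/\varphi)^2\big)$; and for all $t\ge1$ $$V_t=(1-\Theta_t/\varphi)(c+V_{t-1})+\varepsilon_t .$$ Moreover $(\Theta_t,\varepsilon_t)$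 is independent of $V_{t-1}$, and the conditional law of $V_t$ given $V_{t-1}=v$ and $\Theta_t=\theta$ is normal with mean $(1-\theta/\varphi)(v+c)$ and variance $\varphi\bar\varphi\big(1-(1-\theta/\varphi)^2\big)$. 2. (Convergence.) For every $T\ge0$, as $N\to\infty$, $\big(V^{(N)}_0,\dots,V^{(N)}_T,\|Z^{(N)}_1\|/N,\dots,\|Z^{(N)}_T\|/N\big)$ converges in distribution to $(V_0,\dots,V_T,\Theta_1,\dots,\Theta_T)$. 3. (Constant coefficient.) If $\nu=\delta_\theta$, then almost surely $V_t=(1-\theta/\varphi)(c+V_{t-1})+\varepsilon_t$ for all $t\ge1$, with $\varepsilon_t$ normal with mean $0$ and variance $\varphi\bar\varphi(1-(1-\theta/\varphi)^2)$. If in addition $\theta>0$, the normal law with mean $\varphi c(1-\theta/\varphi)/\theta$ and variance $\varphi\bar\varphi$ is stationary: if $\mu_0$ is this law, then $V_t\sim\mu_0$ for all $t$. If moreover $\theta<2\varphi$ (which only excludes $\theta=1$, $\varphi=1/2$), it is the only stationary law: if $V_t\sim\mu_0$ for all $t$, then $\mu_0$ is this normal law. -/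

import Mathlib

open MeasureTheory ProbabilityTheory Filter Topology

/-- The vertex set `{0,1}^N` of the hypercube. -/
abbrev Cube (N : ℕ) : Type := Fin N → Bool

/-- The numerical value `0` or `1` of a coordinate. -/
def bit (b : Bool) : ℝ := if b then 1 else 0

/-- The Hamming distance `‖x‖` of `x` from `0`: the number of coordinates equal to one. -/
def hammingNorm01 {N : ℕ} (x : Cube N) : ℕ := (Finset.univ.filter fun k => x k = true).card

/-- The conditional transition probability `ℙ(X_t = y ∣ X_{t-1} = x, Z_t = z)`, where
`α = min φ γ`:
`φ^‖y‖ (1-φ)^(N-‖y‖) ∏_k {1 + α/(1-α) (1 - z[k]/α) (1 - y[k]/φ) (1 - x[k]/γ)}`. -/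
noncomputable def transProb {N : ℕ} (φ γ : ℝ) (z x y : Cube N) : ℝ :=
  φ ^ hammingNorm01 y * (1 - φ) ^ (N - hammingNorm01 y) *
    ∏ k, (1 + min φ γ / (1 - min φ γ) * (1 - bit (z k) / min φ γ) *
      (1 - bit (y k) / φ) * (1 - bit (x k) / γ))

/-- A law on the hypercube is exchangeable if it is invariant under coordinate permutations. -/
def IsExchangeable {N : ℕ} (ζ : Measure (Cube N)) : Prop :=
  ∀ σ : Equiv.Perm (Fin N), ζ.map (fun z => z ∘ σ) = ζ

/-- `(X_t)_{t ≥ 0}` is a time-homogeneous long-range random walk on `{0,1}^N` with parameters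
`φ, γ`, driven by `(Z_t)_{t ≥ 1}`: at each time `t ≥ 1` the variable `Z_t` is independent of
the past `(X_s)_{s < t}, (Z_s)_{s < t}` and has law `ζ`, and, given the past and `Z_t = z`,
`X_t` is distributed according to `transProb φ γ z X_{t-1}`. The law of `X_0` is arbitrary. -/
structure IsDrivenWalk {N : ℕ} {Ω : Type*} [MeasurableSpace Ω] (φ γ : ℝ)
    (ζ : Measure (Cube N)) (P : Measure Ω) (X Z : ℕ → Ω → Cube N) : Prop where
  measurable_X : ∀ t, Measurable (X t)
  measurable_Z : ∀ t, Measurable (Z t)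
  path_prob : ∀ (T : ℕ) (x z : ℕ → Cube N),
    P {ω | X 0 ω = x 0 ∧ ∀ t < T, Z (t + 1) ω = z (t + 1) ∧ X (t + 1) ω = x (t + 1)} =
      P {ω | X 0 ω = x 0} *
        ∏ t ∈ Finset.range T,
          (ζ {z (t + 1)} * ENNReal.ofReal (transProb φ γ (z (t + 1)) (x t) (x (t + 1))))

/-- The conditional innovation variance `φ (1-φ) (1 - (1-θ/φ)²)`. -/
noncomputable def innovVar (φ θ : ℝ) : ℝ := φ * (1 - φ) * (1 - (1 - θ / φ) ^ 2)

/-- `(V_t)_{t ≥ 0}` is a normal AR(1) series with random coefficients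
`V_t = (1 - Θ_t/φ)(c + V_{t-1}) + ε_t`, `t ≥ 1`, started from `V_0 ∼ μ₀`: the pairs
`(Θ_t, ε_t)`, `t ≥ 1`, are independent and independent of `V_0`, `Θ_t ∼ ν`, and given
`Θ_t = θ` the innovation `ε_t` is centred normal with variance `φ(1-φ)(1-(1-θ/φ)²)`. -/
structure IsRandomCoefAR1 {Ω : Type*} [MeasurableSpace Ω] (φ c : ℝ) (ν μ₀ : Measure ℝ)
    (P : Measure Ω) [IsProbabilityMeasure P] (V Θ ε : ℕ → Ω → ℝ) : Prop where
  measurable_V : ∀ t, Measurable (V t)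
  measurable_Θ : ∀ t, Measurable (Θ t)
  measurable_ε : ∀ t, Measurable (ε t)
  law_zero : P.map (V 0) = μ₀
  law_Θ : ∀ t, P.map (Θ (t + 1)) = ν
  cond_ε : ∀ t, ∀ᵐ θ ∂ν, condDistrib (ε (t + 1)) (Θ (t + 1)) P θ =
    gaussianReal 0 (innovVar φ θ).toNNReal
  indep_pairs : iIndepFun (fun (t : ℕ) ω => (Θ (t + 1) ω, ε (t + 1) ω)) P
  indep_zero : IndepFun (V 0) (fun ω (t : ℕ) => (Θ (t + 1) ω, ε (t + 1) ω)) P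
  recursion : ∀ t ω, V (t + 1) ω = (1 - Θ (t + 1) ω / φ) * (c + V t ω) + ε (t + 1) ω

/-! Given the current state x and the driving vector z, the product formula makes the coordinates of
the next state independent Bernoulli variables with success probabilities φ - κ u_k g_k, where u_k =
1 - z[k]/α, g_k = 1 - x[k]/γ and κ = α(1-φ)/(1-α). The one-step characteristic function of the
scaled norm is thus a product of factors a + b u_k g_k with |a| ≤ 1 and b = O(N^{-1/2}), and
exchangeability allows averaging this product over all rearrangements of u.

The heart of the proof is that this average is within O(1/N) of the product with every u_k replaced
by the mean q = 1 - ‖z‖/(Nα), as long as the scaled norm of x is bounded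
(`exists_norm_permAvg_prod_sub_le`). In the expansion in powers of b, the degree n part is an
elementary symmetric function e_n(g) times the mean product of n values of u drawn without
replacement, and the latter differs from q^n by at most n²/N. Bounding e_n(g) term by term is too
crude. Since ∑ g_k = O(√N), however, ∏ (1 + t g_k) stays bounded on a circle |t| = r of radius r of
order N^{-1/2}, and Cauchy's estimate yields |b|^n |e_n(g)| = O(2^{-n}).

With q in place of u_k, a third-order expansion of the Bernoulli characteristic functions gives a
Gaussian one, whose explicit mean and variance converge to those of the autoregressive step,
uniformly in z and in x with bounded scaled norm (`eventually_norm_avgKernel_sub_limKernel_le`).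

The limit series lives on a product space, with ε_t = √(variance) ξ_t and ξ_t standard normal.
Convergence is by induction on time: the next driving vector is independent of the past, tightness
makes the locally uniform kernel limit sufficient, and Lévy's theorem adds the new value. For a
constant coefficient ρ, the quotient of a stationary characteristic function by the Gaussian one is
invariant under s ↦ ρ s, so |ρ| < 1 and continuity at 0 force it to be 1. -/

/-- The mean over all permutations `σ` of the product of `u ∘ σ` over `S`: the expected product
of a sample without replacement. -/
noncomputable def permMean {ι : Type*} [Fintype ι] [DecidableEq ι] (u : ι → ℝ) (S : Finset ι) : ℝ :=
  (Fintype.card (Equiv.Perm ι) : ℝ)⁻¹ * ∑ σ : Equiv.Perm ι, ∏ k ∈ S, u (σ k)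

/-! ### Sampling without replacement -/

section permMean

variable {ι : Type*} [Fintype ι] [DecidableEq ι]

lemma permMean_map (u : ι → ℝ) (S : Finset ι) (τ : Equiv.Perm ι) :
    permMean u (S.map τ.toEmbedding) = permMean u S := by
  unfold permMean
  congr 1
  refine Fintype.sum_equiv (Equiv.mulRight τ) _ _ fun σ => ?_
  simp

/-- A bijection between two subsets of a finite type extends to a permutation, and composing with it
only reindexes the sum over permutations. This is what lets elementary symmetric functions be
factored out later. -/
lemma permMean_eq_of_card_eq (u : ι → ℝ) {S T : Finset ι} (h : S.card = T.card) :
    permMean u S = permMean u T := by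
  have e : {x // x ∈ S} ≃ {x // x ∈ T} := Finset.equivOfCardEq h
  have hT : T = S.map (e.extendSubtype).toEmbedding := by
    symm
    apply Finset.eq_of_subset_of_card_le
    · intro x hx
      obtain ⟨y, hy, rfl⟩ := Finset.mem_map.1 hx
      exact Equiv.extendSubtype_mem e y hy
    · simp [h]
  rw [hT, permMean_map]

lemma permAvg_abs_le (f : Equiv.Perm ι → ℝ) (hf : ∀ σ, |f σ| ≤ 1) :
    |(Fintype.card (Equiv.Perm ι) : ℝ)⁻¹ * ∑ σ, f σ| ≤ 1 := by
  have h0 : (0 : ℝ) < Fintype.card (Equiv.Perm ι) := by exact_mod_cast Fintype.card_pos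
  rw [abs_mul, abs_of_pos (inv_pos.2 h0), inv_mul_le_iff₀ h0, mul_one]
  calc |∑ σ, f σ| ≤ ∑ σ, |f σ| := Finset.abs_sum_le_sum_abs _ _
    _ ≤ ∑ _σ : Equiv.Perm ι, (1 : ℝ) := Finset.sum_le_sum fun σ _ => hf σ
    _ = _ := by simp

omit [Fintype ι] [DecidableEq ι] in
lemma abs_prod_le_one {u : ι → ℝ} (hu : ∀ k, |u k| ≤ 1) (S : Finset ι) (σ : Equiv.Perm ι) :
    |∏ k ∈ S, u (σ k)| ≤ 1 := by
  rw [Finset.abs_prod]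
  exact Finset.prod_le_one (fun _ _ => abs_nonneg _) fun k _ => hu _

lemma abs_permMean_le_one {u : ι → ℝ} (hu : ∀ k, |u k| ≤ 1) (S : Finset ι) :
    |permMean u S| ≤ 1 :=
  permAvg_abs_le _ (abs_prod_le_one hu S)

/-- For each σ the total of u equals ∑ u (σ k), so multiplying by it appends one more draw k to the
sample. Every k outside S gives the mean over a set of size |S| + 1; only the |S| repeated draws
differ, each by at most 2. -/
lemma abs_mean_mul_permMean_sub_le [Nonempty ι] {u : ι → ℝ} (hu : ∀ k, |u k| ≤ 1) {S : Finset ι}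
    {l : ι} (hl : l ∉ S) :
    |(∑ k, u k) / Fintype.card ι * permMean u S - permMean u (insert l S)| ≤
      2 * S.card / Fintype.card ι := by
  have hN : (0 : ℝ) < Fintype.card ι := by exact_mod_cast Fintype.card_pos
  set c : ι → ℝ := fun k =>
    (Fintype.card (Equiv.Perm ι) : ℝ)⁻¹ * ∑ σ : Equiv.Perm ι, u (σ k) * ∏ j ∈ S, u (σ j) with hc
  have hc1 : ∀ k, |c k| ≤ 1 := fun k => permAvg_abs_le _ fun σ => by
    rw [abs_mul]
    exact mul_le_one₀ (hu _) (abs_nonneg _) (abs_prod_le_one hu S σ)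
  have hsum : (∑ k, u k) * permMean u S = ∑ k, c k := by
    simp only [hc, permMean]
    rw [← Finset.mul_sum, Finset.sum_comm, ← mul_assoc, mul_comm (∑ k, u k), mul_assoc,
      Finset.mul_sum]
    congr 1
    refine Finset.sum_congr rfl fun σ _ => ?_
    rw [← Finset.sum_mul, Equiv.sum_comp σ u]
  have hout : ∀ k ∈ Sᶜ, c k = permMean u (insert l S) := by
    intro k hk
    have hk : k ∉ S := by simpa using hk
    rw [permMean_eq_of_card_eq u (T := insert k S) (by simp [hl, hk])]
    simp only [hc, permMean, Finset.prod_insert hk]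
  rw [← Finset.sum_add_sum_compl S c, Finset.sum_congr rfl hout, Finset.sum_const,
    Finset.card_compl, nsmul_eq_mul, Nat.cast_sub (Finset.card_le_univ S)] at hsum
  have : (∑ k, u k) / Fintype.card ι * permMean u S - permMean u (insert l S) =
      (∑ k ∈ S, (c k - permMean u (insert l S))) / Fintype.card ι := by
    rw [div_mul_eq_mul_div, hsum, Finset.sum_sub_distrib, Finset.sum_const, nsmul_eq_mul]
    field_simp
    ring
  rw [this, abs_div, abs_of_pos hN]
  gcongr
  calc |∑ k ∈ S, (c k - permMean u (insert l S))|
      ≤ ∑ k ∈ S, |c k - permMean u (insert l S)| := Finset.abs_sum_le_sum_abs _ _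
    _ ≤ ∑ k ∈ S, (2 : ℝ) := Finset.sum_le_sum fun k _ => by
        have := abs_sub (c k) (permMean u (insert l S))
        linarith [hc1 k, abs_permMean_le_one hu (insert l S)]
    _ = 2 * S.card := by simp [mul_comm]

omit [DecidableEq ι] in
lemma abs_mean_le_one [Nonempty ι] {u : ι → ℝ} (hu : ∀ k, |u k| ≤ 1) :
    |(∑ k, u k) / Fintype.card ι| ≤ 1 := by
  have hN : (0 : ℝ) < Fintype.card ι := by exact_mod_cast Fintype.card_pos
  rw [abs_div, abs_of_pos hN, div_le_one hN]
  calc |∑ k, u k| ≤ ∑ k, |u k| := Finset.abs_sum_le_sum_abs _ _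
    _ ≤ ∑ _k : ι, (1 : ℝ) := Finset.sum_le_sum fun σ _ => hu σ
    _ = _ := by simp

/-- Sampling without replacement is close to sampling with replacement. -/
lemma abs_permMean_sub_pow_le [Nonempty ι] {u : ι → ℝ} (hu : ∀ k, |u k| ≤ 1) (S : Finset ι) :
    |permMean u S - ((∑ k, u k) / Fintype.card ι) ^ S.card| ≤
      (S.card : ℝ) ^ 2 / Fintype.card ι := by
  have hN : (0 : ℝ) < Fintype.card ι := by exact_mod_cast Fintype.card_pos
  induction S using Finset.induction_on with
  | empty => simp [permMean]
  | insert l S hl ih =>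
    set q := (∑ k, u k) / Fintype.card ι with hq
    have h1 := abs_mean_mul_permMean_sub_le hu hl
    rw [← hq] at h1
    have hq1 : |q| ≤ 1 := abs_mean_le_one hu
    rw [Finset.card_insert_of_notMem hl, pow_succ]
    -- Each new draw costs 2n/N, and n² + 2n ≤ (n+1)² produces the quadratic bound.
    have h2 : permMean u (insert l S) - q ^ S.card * q =
        q * (permMean u S - q ^ S.card) - (q * permMean u S - permMean u (insert l S)) := by ring
    have h3 : |q * (permMean u S - q ^ S.card)| ≤ (S.card : ℝ) ^ 2 / Fintype.card ι := by
      rw [abs_mul]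
      calc _ ≤ 1 * |permMean u S - q ^ S.card| := by gcongr
        _ ≤ _ := by rw [one_mul]; exact ih
    rw [h2]
    calc _ ≤ _ := abs_sub _ _
      _ ≤ (S.card : ℝ) ^ 2 / Fintype.card ι + 2 * S.card / Fintype.card ι := add_le_add h3 h1
      _ ≤ _ := by
        rw [← add_div]
        gcongr
        push_cast
        nlinarith

end permMean

/-! ### Elementary symmetric functions and Cauchy's estimate -/

section CauchyEstimate

variable {ι : Type*} [Fintype ι] [DecidableEq ι]

/-- The elementary symmetric function of degree `n` of a family of complex numbers. -/
noncomputable def symmFun (g : ι → ℂ) (n : ℕ) : ℂ :=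
  ∑ S ∈ Finset.powersetCard n Finset.univ, ∏ k ∈ S, g k

omit [DecidableEq ι] in
lemma prod_one_add_mul_eq_sum (g : ι → ℂ) (t : ℂ) :
    ∏ k, (1 + t * g k) = ∑ n ∈ Finset.range (Fintype.card ι + 1), symmFun g n * t ^ n := by
  rw [Finset.prod_one_add, Finset.sum_powerset]
  refine Finset.sum_congr rfl fun n _ => ?_
  rw [symmFun, Finset.sum_mul]
  refine Finset.sum_congr rfl fun S hS => ?_
  rw [Finset.prod_mul_distrib, Finset.prod_const, (Finset.mem_powersetCard.1 hS).2, mul_comm]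

omit [DecidableEq ι] in
/-- Cauchy's estimate for elementary symmetric functions. -/
lemma norm_symmFun_mul_pow_le (g : ι → ℂ) {r C : ℝ} (hr : 0 < r)
    (hC : ∀ t : ℂ, ‖t‖ = r → ‖∏ k, (1 + t * g k)‖ ≤ C) {n : ℕ} (hn : n ≤ Fintype.card ι) :
    ‖symmFun g n‖ ≤ C / r ^ n := by
  set p : Polynomial ℂ := ∑ n ∈ Finset.range (Fintype.card ι + 1),
    Polynomial.C (symmFun g n) * Polynomial.X ^ n with hp
  have hev : ∀ t, p.eval t = ∏ k, (1 + t * g k) := fun t => by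
    rw [prod_one_add_mul_eq_sum, hp, Polynomial.eval_finsetSum]
    simp
  have hco : p.coeff n = symmFun g n := by
    simp [hp, Polynomial.coeff_X_pow]
    intro h; omega
  have h := Complex.norm_iteratedDeriv_le_of_forall_mem_sphere_norm_le (f := fun t => p.eval t)
    (c := 0) n hr (p.differentiable.diffContOnCl) (C := C) fun t ht => by
      rw [hev]; exact hC t (by simpa using ht)
  have hd : iteratedDeriv n (fun t => p.eval t) 0 = n.factorial * symmFun g n := by
    have : iteratedDeriv n (fun t => p.eval t) = fun t => (Polynomial.derivative^[n] p).eval t := by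
      rw [iteratedDeriv_eq_iterate]
      clear h hco hev hn
      generalize p = p
      induction n generalizing p with
      | zero => rfl
      | succ n ih =>
        rw [Function.iterate_succ_apply, Function.iterate_succ_apply, ← ih]
        congr 1
        ext t
        simp
    rw [this]
    simp only [← Polynomial.coeff_zero_eq_eval_zero, Polynomial.coeff_iterate_derivative]
    rw [zero_add, hco, Nat.descFactorial_self, nsmul_eq_mul]
  rw [hd, norm_mul, Complex.norm_natCast, mul_div_assoc] at h
  exact le_of_mul_le_mul_left h (by exact_mod_cast n.factorial_pos)

end CauchyEstimate

/-! ### Averaging a product over rearrangements of its factors -/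

section Exchange

variable {ι : Type*} [Fintype ι] [DecidableEq ι]

lemma prod_add_mul_mul_eq_sum (a b : ℂ) (g : ι → ℂ) (u : ι → ℝ) :
    ∏ k, (a + b * u k * g k) = ∑ n ∈ Finset.range (Fintype.card ι + 1),
      ∑ S ∈ Finset.powersetCard n Finset.univ,
        a ^ (Fintype.card ι - n) * b ^ n * (∏ k ∈ S, g k) * ((∏ k ∈ S, u k : ℝ) : ℂ) := by
  simp_rw [add_comm a]
  rw [Finset.prod_add, Finset.sum_powerset]
  refine Finset.sum_congr rfl fun n _ => Finset.sum_congr rfl fun S hS => ?_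
  have hS := (Finset.mem_powersetCard.1 hS).2
  rw [Finset.prod_mul_distrib, Finset.prod_mul_distrib, Finset.prod_const, Finset.prod_const,
    Finset.card_sdiff_of_subset (Finset.subset_univ S), hS, Finset.card_univ]
  push_cast
  ring

/-- Averaging a product over all rearrangements of the factors `u` is close to replacing `u` by
its mean. -/
lemma norm_permAvg_prod_sub_le [Nonempty ι] {a b : ℂ} (ha : ‖a‖ ≤ 1) (g : ι → ℂ) {u : ι → ℝ}
    (hu : ∀ k, |u k| ≤ 1) :
    ‖(Fintype.card (Equiv.Perm ι) : ℂ)⁻¹ * ∑ σ : Equiv.Perm ι, ∏ k, (a + b * u (σ k) * g k) -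
        ∏ k, (a + b * ((∑ k, u k) / Fintype.card ι : ℝ) * g k)‖ ≤
      ∑ n ∈ Finset.range (Fintype.card ι + 1),
        ‖b‖ ^ n * ‖symmFun g n‖ * ((n : ℝ) ^ 2 / Fintype.card ι) := by
  set q := (∑ k, u k) / Fintype.card ι with hq
  have h1 : (Fintype.card (Equiv.Perm ι) : ℂ)⁻¹ *
      ∑ σ : Equiv.Perm ι, ∏ k, (a + b * u (σ k) * g k) =
      ∑ n ∈ Finset.range (Fintype.card ι + 1), ∑ S ∈ Finset.powersetCard n Finset.univ,
        a ^ (Fintype.card ι - n) * b ^ n * (∏ k ∈ S, g k) * (permMean u S : ℂ) := by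
    simp_rw [fun σ : Equiv.Perm ι => prod_add_mul_mul_eq_sum a b g (fun k => u (σ k))]
    rw [Finset.sum_comm, Finset.mul_sum]
    refine Finset.sum_congr rfl fun n _ => ?_
    rw [Finset.sum_comm, Finset.mul_sum]
    refine Finset.sum_congr rfl fun S hS => ?_
    rw [← Finset.mul_sum, permMean]
    push_cast
    ring
  have h2 := prod_add_mul_mul_eq_sum a b g (fun _ => q)
  rw [h1, h2, ← Finset.sum_sub_distrib]
  refine (norm_sum_le _ _).trans (Finset.sum_le_sum fun n hn => ?_)
  have hn : n ≤ Fintype.card ι := by simpa [Nat.lt_succ_iff] using hn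
  obtain ⟨S₀, -, hS₀⟩ := Finset.exists_subset_card_eq (s := (Finset.univ : Finset ι)) (n := n) hn
  -- The permutation mean is the same for all S of size n, so its distance to q ^ n factors out of
  -- the degree n layer and leaves `symmFun g n`.
  have h3 : ∑ S ∈ Finset.powersetCard n Finset.univ,
        a ^ (Fintype.card ι - n) * b ^ n * (∏ k ∈ S, g k) * (permMean u S : ℂ) -
      ∑ S ∈ Finset.powersetCard n Finset.univ,
        a ^ (Fintype.card ι - n) * b ^ n * (∏ k ∈ S, g k) * ((∏ k ∈ S, q : ℝ) : ℂ) =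
      a ^ (Fintype.card ι - n) * (b ^ n * symmFun g n * ((permMean u S₀ - q ^ n : ℝ) : ℂ)) := by
    rw [← Finset.sum_sub_distrib, symmFun, Finset.mul_sum, Finset.sum_mul, Finset.mul_sum]
    refine Finset.sum_congr rfl fun S hS => ?_
    have hS := (Finset.mem_powersetCard.1 hS).2
    rw [permMean_eq_of_card_eq u (hS.trans hS₀.symm), Finset.prod_const, hS]
    push_cast
    ring
  rw [h3, norm_mul, norm_mul, norm_mul, norm_pow, norm_pow, Complex.norm_real, Real.norm_eq_abs]
  have h4 := abs_permMean_sub_pow_le hu S₀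
  rw [hS₀] at h4
  calc _ ≤ 1 * (‖b‖ ^ n * ‖symmFun g n‖ * ((n : ℝ) ^ 2 / Fintype.card ι)) := by
        gcongr
        exact pow_le_one₀ (norm_nonneg _) ha
    _ = _ := one_mul _

-- Comes from |1 + w|² = 1 + 2 Re w + |w|² ≤ exp(2 Re w + |w|²). The linear terms are summed before
-- taking absolute values, so the cancellation in ∑ g_k is kept; bounding factor by factor would
-- lose it.
omit [DecidableEq ι] in
lemma norm_prod_one_add_le {g : ι → ℝ} (hg : ∀ k, |g k| ≤ 1) (t : ℂ) :
    ‖∏ k, (1 + t * (g k : ℂ))‖ ≤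
      Real.exp (‖t‖ * |∑ k, g k| + Fintype.card ι * ‖t‖ ^ 2 / 2) := by
  have key : ∀ w : ℂ, ‖1 + w‖ ≤ Real.exp (w.re + ‖w‖ ^ 2 / 2) := by
    intro w
    have h : ‖1 + w‖ ^ 2 = 1 + (2 * w.re + ‖w‖ ^ 2) := by
      rw [Complex.sq_norm, Complex.sq_norm, Complex.normSq_apply, Complex.normSq_apply]
      simp
      ring
    have h2 : ‖1 + w‖ ^ 2 ≤ Real.exp (w.re + ‖w‖ ^ 2 / 2) ^ 2 := by
      rw [h, ← Real.exp_nat_mul]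
      have := Real.add_one_le_exp (2 * w.re + ‖w‖ ^ 2)
      convert! (show 1 + (2 * w.re + ‖w‖ ^ 2) ≤ Real.exp (2 * w.re + ‖w‖ ^ 2) by linarith) using 2
      push_cast
      ring
    exact le_of_sq_le_sq h2 (Real.exp_pos _).le
  rw [norm_prod]
  calc ∏ k, ‖1 + t * (g k : ℂ)‖ ≤ ∏ k, Real.exp (t.re * g k + ‖t‖ ^ 2 / 2) := by
        refine Finset.prod_le_prod (fun _ _ => norm_nonneg _) fun k _ => (key _).trans ?_
        rw [Real.exp_le_exp, norm_mul, Complex.norm_real, Real.norm_eq_abs, mul_pow]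
        have : (t * (g k : ℂ)).re = t.re * g k := by simp
        rw [this]
        have : |g k| ^ 2 ≤ 1 := pow_le_one₀ (abs_nonneg _) (hg k)
        nlinarith [sq_nonneg ‖t‖]
    _ = Real.exp (t.re * (∑ k, g k) + Fintype.card ι * ‖t‖ ^ 2 / 2) := by
        rw [← Real.exp_sum, Finset.sum_add_distrib, ← Finset.mul_sum]
        simp [mul_div_assoc]
    _ ≤ _ := by
        rw [Real.exp_le_exp]
        refine add_le_add_left ?_ _
        calc t.re * ∑ k, g k ≤ |t.re * ∑ k, g k| := le_abs_self _
          _ = |t.re| * |∑ k, g k| := abs_mul _ _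
          _ ≤ _ := by gcongr; exact Complex.abs_re_le_norm t

/-- The averaging estimate in quantitative form, on the scale `b = O(N^{-1/2})`. -/
lemma exists_norm_permAvg_prod_sub_le (s B : ℝ) (hs : 0 < s) :
    ∃ D : ℝ, ∀ (ι : Type) [Fintype ι] [DecidableEq ι] [Nonempty ι] (a b : ℂ) (g u : ι → ℝ),
      ‖a‖ ≤ 1 → ‖b‖ ≤ s / √(Fintype.card ι) → (∀ k, |u k| ≤ 1) → (∀ k, |g k| ≤ 1) →
      |∑ k, g k| ≤ B * √(Fintype.card ι) →
      ‖(Fintype.card (Equiv.Perm ι) : ℂ)⁻¹ * ∑ σ : Equiv.Perm ι, ∏ k, (a + b * u (σ k) * g k) -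
          ∏ k, (a + b * ((∑ k, u k) / Fintype.card ι : ℝ) * g k)‖ ≤ D / Fintype.card ι := by
  have hsumm : Summable fun n : ℕ => (n : ℝ) ^ 2 * (1 / 2 : ℝ) ^ n :=
    summable_pow_mul_geometric_of_norm_lt_one 2 (by norm_num)
  -- The radius for Cauchy's estimate is 2s/√N, twice the bound on ‖b‖. The ratio of the two
  -- supplies the factor (1/2)^n that makes the series of n² converge, and the exponential bounds
  -- the product on that circle.
  refine ⟨Real.exp (2 * s * B + (2 * s) ^ 2 / 2) * ∑' n : ℕ, (n : ℝ) ^ 2 * (1 / 2 : ℝ) ^ n, ?_⟩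
  intro ι _ _ _ a b g u ha hb hu hg hB
  have hN : (0 : ℝ) < Fintype.card ι := by exact_mod_cast Fintype.card_pos
  have hsq : (0 : ℝ) < √(Fintype.card ι) := Real.sqrt_pos.2 hN
  have hsq2 : √(Fintype.card ι : ℝ) ^ 2 = Fintype.card ι := Real.sq_sqrt hN.le
  set N : ℝ := (Fintype.card ι : ℝ) with hNdef
  set C := Real.exp (2 * s * B + (2 * s) ^ 2 / 2) with hC
  have hr : 0 < 2 * s / √N := by positivity
  have hbound : ∀ t : ℂ, ‖t‖ = 2 * s / √N → ‖∏ k, (1 + t * (g k : ℂ))‖ ≤ C := by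
    intro t ht
    refine (norm_prod_one_add_le hg t).trans ?_
    rw [hC, Real.exp_le_exp, ht]
    have h1 : 2 * s / √N * |∑ k, g k| ≤ 2 * s * B := by
      calc _ ≤ 2 * s / √N * (B * √N) := by gcongr
        _ = _ := by field_simp
    have h2 : N * (2 * s / √N) ^ 2 / 2 = (2 * s) ^ 2 / 2 := by
      rw [div_pow, hsq2]; field_simp
    rw [← hNdef, h2]
    linarith
  refine (norm_permAvg_prod_sub_le ha (fun k => (g k : ℂ)) hu).trans ?_
  rw [← hNdef]
  have hterm : ∀ n ∈ Finset.range (Fintype.card ι + 1),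
      ‖b‖ ^ n * ‖symmFun (fun k => (g k : ℂ)) n‖ * ((n : ℝ) ^ 2 / N) ≤
        C / N * ((n : ℝ) ^ 2 * (1 / 2 : ℝ) ^ n) := by
    intro n hn
    have hn : n ≤ Fintype.card ι := by simpa [Nat.lt_succ_iff] using hn
    have h1 := norm_symmFun_mul_pow_le (fun k => (g k : ℂ)) hr hbound hn
    calc _ ≤ (s / √N) ^ n * (C / (2 * s / √N) ^ n) * ((n : ℝ) ^ 2 / N) := by gcongr
      _ = _ := by
        have : (s / √N) ^ n = (2 * s / √N) ^ n * (1 / 2 : ℝ) ^ n := by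
          rw [← mul_pow]; congr 1; ring
        rw [this]
        field_simp
  calc _ ≤ _ := Finset.sum_le_sum hterm
    _ = C / N * ∑ n ∈ Finset.range (Fintype.card ι + 1), (n : ℝ) ^ 2 * (1 / 2 : ℝ) ^ n := by
        rw [Finset.mul_sum]
    _ ≤ C / N * ∑' n : ℕ, (n : ℝ) ^ 2 * (1 / 2 : ℝ) ^ n := by
        gcongr
        exact hsumm.sum_le_tsum _ fun n _ => by positivity
    _ = _ := by ring

end Exchange

/-! ### Exponentials, products and Bernoulli characteristic functions -/

section Estimates

/-- The derivative of exp has norm exp(Re z) ≤ 1 on the closed left half-plane, which is convex. The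
exponents compared later have real part minus half a variance term. -/
lemma norm_exp_sub_exp_le {a b : ℂ} (ha : a.re ≤ 0) (hb : b.re ≤ 0) :
    ‖Complex.exp a - Complex.exp b‖ ≤ ‖a - b‖ := by
  have h := Convex.norm_image_sub_le_of_norm_deriv_le (𝕜 := ℂ) (f := Complex.exp) (C := 1)
    (s := {z : ℂ | z.re ≤ 0}) (x := b) (y := a) (fun x _ => Complex.differentiableAt_exp)
    (fun x hx => by
      rw [Complex.deriv_exp, Complex.norm_exp]
      exact Real.exp_le_one_iff.2 hx)
    (convex_halfSpace_re_le 0) hb ha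
  simpa using h

/-- Telescoping: the factors are exchanged one at a time while all others have norm at most 1. -/
lemma norm_prod_sub_prod_le {ι : Type*} (S : Finset ι) {a b : ι → ℂ} (ha : ∀ k, ‖a k‖ ≤ 1)
    (hb : ∀ k, ‖b k‖ ≤ 1) :
    ‖∏ k ∈ S, a k - ∏ k ∈ S, b k‖ ≤ ∑ k ∈ S, ‖a k - b k‖ := by
  classical
  induction S using Finset.induction_on with
  | empty => simp
  | insert l S hl ih =>
    rw [Finset.prod_insert hl, Finset.prod_insert hl, Finset.sum_insert hl]
    have h : a l * ∏ k ∈ S, a k - b l * ∏ k ∈ S, b k =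
        (a l - b l) * ∏ k ∈ S, a k + b l * (∏ k ∈ S, a k - ∏ k ∈ S, b k) := by ring
    have h1 : ‖∏ k ∈ S, a k‖ ≤ 1 := by
      rw [norm_prod]
      exact Finset.prod_le_one (fun _ _ => norm_nonneg _) fun k _ => ha k
    rw [h]
    refine (norm_add_le _ _).trans ?_
    rw [norm_mul, norm_mul]
    refine add_le_add (mul_le_of_le_one_right (norm_nonneg _) h1) ?_
    exact (mul_le_of_le_one_left (norm_nonneg _) (hb l)).trans ih

lemma norm_one_add_mul_exp_sub_one_le {p : ℝ} (hp : p ∈ Set.Icc (0 : ℝ) 1) (t : ℝ) :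
    ‖1 + (p : ℂ) * (Complex.exp (t * Complex.I) - 1)‖ ≤ 1 := by
  have h : 1 + (p : ℂ) * (Complex.exp (t * Complex.I) - 1) =
      ((1 - p : ℝ) : ℂ) + (p : ℂ) * Complex.exp (t * Complex.I) := by push_cast; ring
  rw [h]
  refine (norm_add_le _ _).trans ?_
  rw [norm_mul, Complex.norm_exp_ofReal_mul_I, Complex.norm_real, Complex.norm_real,
    Real.norm_of_nonneg (by linarith [hp.2]), Real.norm_of_nonneg hp.1]
  linarith

/-- Third-order expansion of the characteristic function of a Bernoulli variable. -/
lemma norm_bernoulli_charFun_sub_le {p t : ℝ} (hp : p ∈ Set.Icc (0 : ℝ) 1) (ht : |t| ≤ 1 / 2) :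
    ‖1 + (p : ℂ) * (Complex.exp (t * Complex.I) - 1) -
      Complex.exp (p * t * Complex.I - p * (1 - p) * t ^ 2 / 2)‖ ≤ 5 * |t| ^ 3 := by
  have hp0 := hp.1
  have hp1 := hp.2
  set z : ℂ := p * t * Complex.I - p * (1 - p) * t ^ 2 / 2 with hz
  set r₁ : ℂ := Complex.exp (t * Complex.I) - (1 + t * Complex.I - t ^ 2 / 2) with hr₁
  set r₂ : ℂ := Complex.exp z - (1 + z + z ^ 2 / 2) with hr₂
  have ht0 := abs_nonneg t
  have hexp : ∀ w : ℂ, ‖w‖ ≤ 1 → ‖Complex.exp w - (1 + w + w ^ 2 / 2)‖ ≤ ‖w‖ ^ 3 / 4 := by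
    intro w hw
    have h := Complex.exp_bound hw (n := 3) (by norm_num)
    simp only [Finset.sum_range_succ, Finset.sum_range_zero] at h
    norm_num [Nat.factorial] at h
    refine h.trans ?_
    have := pow_nonneg (norm_nonneg w) 3
    linarith
  have h1 : ‖r₁‖ ≤ |t| ^ 3 := by
    have hn : ‖(t : ℂ) * Complex.I‖ = |t| := by simp
    have h := hexp (t * Complex.I) (by rw [hn]; linarith)
    rw [hn, mul_pow, Complex.I_sq] at h
    have e : r₁ = Complex.exp (t * Complex.I) -
      (1 + t * Complex.I + (t : ℂ) ^ 2 * (-1) / 2) := by rw [hr₁]; ring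
    rw [e]
    have := pow_nonneg ht0 3
    linarith
  -- The assumption |t| ≤ 1/2 is chosen so that this keeps z in the unit disc, where `hexp` applies.
  have hzn : ‖z‖ ≤ 2 * |t| := by
    have e1 : ‖(p : ℂ) * t * Complex.I‖ = p * |t| := by
      simp [abs_of_nonneg hp0]
    have e2 : (p : ℂ) * (1 - p) * t ^ 2 / 2 = ((p * (1 - p) * t ^ 2 / 2 : ℝ) : ℂ) := by
      push_cast; ring
    have e3 : ‖(p : ℂ) * (1 - p) * t ^ 2 / 2‖ = p * (1 - p) * |t| ^ 2 / 2 := by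
      rw [e2, Complex.norm_real, Real.norm_of_nonneg, sq_abs]
      have : 0 ≤ 1 - p := by linarith
      positivity
    refine (norm_sub_le _ _).trans ?_
    rw [e1, e3]
    have : p * (1 - p) ≤ 1 := by nlinarith
    have h2 : p * (1 - p) * |t| ^ 2 ≤ 1 * |t| ^ 2 := by gcongr
    nlinarith
  have h2 : ‖r₂‖ ≤ 2 * |t| ^ 3 := by
    have h := hexp z (by linarith)
    calc ‖r₂‖ ≤ ‖z‖ ^ 3 / 4 := h
      _ ≤ (2 * |t|) ^ 3 / 4 := by gcongr
      _ = _ := by ring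
  -- The two expansions agree through order t². What is left are the Taylor remainders and the cubic
  -- and quartic terms of z²/2; they contribute 1 + 1 + 1 + 2 = 5 times |t|³.
  have hmain : 1 + (p : ℂ) * (Complex.exp (t * Complex.I) - 1) - Complex.exp z =
      p * r₁ + (p ^ 2 * (1 - p) / 2 * t ^ 3 : ℝ) * Complex.I -
        (p ^ 2 * (1 - p) ^ 2 / 8 * t ^ 4 : ℝ) - r₂ := by
    have hI : Complex.I ^ 2 = -1 := Complex.I_sq
    have : z ^ 2 = -(p : ℂ) ^ 2 * t ^ 2 - (p : ℂ) ^ 2 * (1 - p) * t ^ 3 * Complex.I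
        + (p : ℂ) ^ 2 * (1 - p) ^ 2 * t ^ 4 / 4 := by
      rw [hz]
      linear_combination ((p : ℂ) ^ 2 * t ^ 2) * hI
    rw [hr₁, hr₂, this, hz]
    push_cast
    ring
  rw [hmain]
  have hq : 0 ≤ 1 - p := by linarith
  have b1 : ‖(p : ℂ) * r₁‖ ≤ |t| ^ 3 := by
    rw [norm_mul, Complex.norm_real, Real.norm_of_nonneg hp0]
    exact (mul_le_of_le_one_left (norm_nonneg _) hp1).trans h1
  have b2 : ‖((p ^ 2 * (1 - p) / 2 * t ^ 3 : ℝ) : ℂ) * Complex.I‖ ≤ |t| ^ 3 := by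
    rw [norm_mul, Complex.norm_I, mul_one, Complex.norm_real, Real.norm_eq_abs, abs_mul, abs_pow,
      abs_of_nonneg (by positivity)]
    refine mul_le_of_le_one_left (by positivity) ?_
    have : p ^ 2 * (1 - p) ≤ 1 * 1 := by
      gcongr
      · nlinarith
      · linarith
    linarith
  have b3 : ‖((p ^ 2 * (1 - p) ^ 2 / 8 * t ^ 4 : ℝ) : ℂ)‖ ≤ |t| ^ 3 := by
    rw [Complex.norm_real, Real.norm_eq_abs, abs_mul, abs_pow, abs_of_nonneg (by positivity)]
    have h : p ^ 2 * (1 - p) ^ 2 ≤ 1 * 1 := by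
      gcongr
      · nlinarith
      · nlinarith
    have h4 : |t| ^ 4 ≤ |t| ^ 3 := pow_le_pow_of_le_one ht0 (by linarith) (by norm_num)
    calc _ ≤ 1 * |t| ^ 4 := by
          gcongr
          linarith
      _ ≤ _ := by linarith
  calc _ ≤ ‖(p : ℂ) * r₁‖ + ‖((p ^ 2 * (1 - p) / 2 * t ^ 3 : ℝ) : ℂ) * Complex.I‖ +
        ‖((p ^ 2 * (1 - p) ^ 2 / 8 * t ^ 4 : ℝ) : ℂ)‖ + ‖r₂‖ := by
        refine (norm_sub_le _ _).trans ?_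
        gcongr
        refine (norm_sub_le _ _).trans ?_
        gcongr
        exact norm_add_le _ _
    _ ≤ _ := by linarith

end Estimates

/-! ### The one-step transition as a product of Bernoulli laws -/

section Transition

variable {N : ℕ} {φ γ α : ℝ}

/-- The probability that a coordinate equals one after a step, as a function of the centred
driving coordinate `u = 1 - z/α` and the centred current coordinate `g = 1 - x/γ`. -/
noncomputable def jumpProb (φ α u g : ℝ) : ℝ := φ - α / (1 - α) * (1 - φ) * u * g

/-- The three parameter conditions each give one inequality: α ≤ φ gives κ(1-φ) ≤ φ, α ≤ γ gives κh
≤ 1, and φ + γ ≥ 1 gives (1-φ)h ≤ φ, with κ = α/(1-α) and h = (1-γ)/γ. The variable u ranges over a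
whole interval because the averaged driving coordinate is substituted for it later. -/
lemma jumpProb_mem_Icc (hφ : φ ∈ Set.Ioo (0 : ℝ) 1) (hγ : γ ∈ Set.Ioo (0 : ℝ) 1)
    (hsum : 1 ≤ φ + γ) (hα : min φ γ = α) {u g : ℝ} (hu : -((1 - α) / α) ≤ u) (hu1 : u ≤ 1)
    (hg : g = 1 ∨ g = 1 - 1 / γ) : jumpProb φ α u g ∈ Set.Icc (0 : ℝ) 1 := by
  obtain ⟨hφ0, hφ1⟩ := hφ
  obtain ⟨hγ0, hγ1⟩ := hγ
  have hα0 : 0 < α := hα ▸ lt_min hφ0 hγ0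
  have hαφ : α ≤ φ := hα ▸ min_le_left _ _
  have hαγ : α ≤ γ := hα ▸ min_le_right _ _
  have hα1 : 0 < 1 - α := by linarith
  set κ := α / (1 - α) with hκ
  have hκ0 : 0 < κ := by positivity
  have hκu : -1 ≤ κ * u := by
    have := mul_le_mul_of_nonneg_left hu hκ0.le
    have e : κ * -((1 - α) / α) = -1 := by rw [hκ]; field_simp
    linarith
  have hκu1 : κ * u ≤ κ := by nlinarith
  have hκφ : κ * (1 - φ) ≤ φ := by
    rw [hκ, div_mul_eq_mul_div, div_le_iff₀ hα1]; nlinarith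
  unfold jumpProb
  rw [← hκ]
  rcases hg with rfl | rfl
  · constructor <;> nlinarith
  · set h := (1 - γ) / γ with hh
    have e : 1 - 1 / γ = -h := by rw [hh]; field_simp; ring
    have hh0 : 0 ≤ h := div_nonneg (by linarith) hγ0.le
    have hκh : κ * h ≤ 1 := by
      rw [hκ, hh, div_mul_div_comm, div_le_one (by positivity)]; nlinarith
    have hφh : (1 - φ) * h ≤ φ := by
      rw [hh, mul_div_assoc', div_le_iff₀ hγ0]; nlinarith
    have h1 : κ * u * h ≤ 1 := (mul_le_mul_of_nonneg_right hκu1 hh0).trans hκh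
    have h2 : -h ≤ κ * u * h := by nlinarith
    rw [e]
    constructor
    · nlinarith
    · nlinarith

/-- Given x and z the new coordinates are independent Bernoulli variables: multiplying a factor of
the product by φ or 1 - φ turns it into the jump probability or its complement. -/
lemma transProb_eq_prod (hφ : φ ∈ Set.Ioo (0 : ℝ) 1) (hα : min φ γ = α) (z x y : Cube N) :
    transProb φ γ z x y = ∏ k, if y k = true
      then jumpProb φ α (1 - bit (z k) / α) (1 - bit (x k) / γ)
      else 1 - jumpProb φ α (1 - bit (z k) / α) (1 - bit (x k) / γ) := by
  have hφ0 : φ ≠ 0 := hφ.1.ne'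
  have h : φ ^ hammingNorm01 y * (1 - φ) ^ (N - hammingNorm01 y) =
      ∏ k, if y k = true then φ else 1 - φ := by
    rw [Finset.prod_ite, Finset.prod_const, Finset.prod_const, hammingNorm01]
    congr 2
    have := Finset.card_filter_add_card_filter_not (s := (Finset.univ : Finset (Fin N)))
      (fun k => y k = true)
    simp only [Finset.card_univ, Fintype.card_fin] at this
    omega
  rw [transProb, h, ← Finset.prod_mul_distrib, hα]
  refine Finset.prod_congr rfl fun k _ => ?_
  unfold jumpProb bit
  split_ifs <;> field_simp <;> ring

lemma neg_le_one_sub_bit_div (hα : 0 < α) (b : Bool) : -((1 - α) / α) ≤ 1 - bit b / α := by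
  have : bit b ≤ 1 := by unfold bit; split_ifs <;> norm_num
  rw [neg_le_sub_iff_le_add, ← sub_le_iff_le_add', sub_div]
  have : bit b / α ≤ 1 / α := by gcongr
  rw [div_self hα.ne']
  linarith

lemma one_sub_bit_div_le (hα : 0 < α) (b : Bool) : 1 - bit b / α ≤ 1 := by
  have : 0 ≤ bit b := by unfold bit; split_ifs <;> norm_num
  have : 0 ≤ bit b / α := by positivity
  linarith

lemma one_sub_bit_div_eq (γ : ℝ) (b : Bool) : 1 - bit b / γ = 1 ∨ 1 - bit b / γ = 1 - 1 / γ := by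
  unfold bit; cases b <;> simp

lemma transProb_nonneg (hφ : φ ∈ Set.Ioo (0 : ℝ) 1) (hγ : γ ∈ Set.Ioo (0 : ℝ) 1)
    (hsum : 1 ≤ φ + γ) (z x y : Cube N) : 0 ≤ transProb φ γ z x y := by
  have hα0 : 0 < min φ γ := lt_min hφ.1 hγ.1
  rw [transProb_eq_prod hφ rfl]
  refine Finset.prod_nonneg fun k _ => ?_
  have := jumpProb_mem_Icc hφ hγ hsum rfl (neg_le_one_sub_bit_div hα0 (z k))
    (one_sub_bit_div_le hα0 (z k)) (one_sub_bit_div_eq γ (x k))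
  split_ifs
  · exact this.1
  · linarith [this.2]

/-- Independence of the coordinates. With h = 1 it gives total mass one, with h exponential the
characteristic function. -/
lemma sum_transProb_mul_prod (hφ : φ ∈ Set.Ioo (0 : ℝ) 1) (hα : min φ γ = α) (z x : Cube N)
    (h : Bool → ℂ) :
    ∑ y, (transProb φ γ z x y : ℂ) * ∏ k, h (y k) =
      ∏ k, (h false + (jumpProb φ α (1 - bit (z k) / α) (1 - bit (x k) / γ) : ℂ) *
        (h true - h false)) := by
  have e : ∀ k : Fin N, h false + (jumpProb φ α (1 - bit (z k) / α) (1 - bit (x k) / γ) : ℂ) *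
        (h true - h false) = ∑ b : Bool, ((if b = true
      then jumpProb φ α (1 - bit (z k) / α) (1 - bit (x k) / γ)
      else 1 - jumpProb φ α (1 - bit (z k) / α) (1 - bit (x k) / γ) : ℝ) : ℂ) * h b := by
    intro k
    simp
    ring
  rw [Finset.prod_congr rfl fun k _ => e k, Fintype.prod_sum]
  refine Finset.sum_congr rfl fun y _ => ?_
  rw [transProb_eq_prod hφ hα, Complex.ofReal_prod, ← Finset.prod_mul_distrib]

lemma sum_transProb (hφ : φ ∈ Set.Ioo (0 : ℝ) 1) (z x : Cube N) :
    ∑ y, transProb φ γ z x y = 1 := by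
  have h := sum_transProb_mul_prod hφ rfl z x (γ := γ) fun _ => 1
  simp only [Finset.prod_const_one, mul_one, sub_self, mul_zero, add_zero] at h
  exact_mod_cast h

/-- The centred and scaled Hamming norm. -/
noncomputable def scaledNorm (φ : ℝ) (x : Cube N) : ℝ := ((hammingNorm01 x : ℝ) - N * φ) / √N

lemma hammingNorm01_eq_sum (x : Cube N) : (hammingNorm01 x : ℝ) = ∑ k, bit (x k) := by
  simp [hammingNorm01, bit]

/-- The characteristic function of the scaled norm after one step, averaged over all
rearrangements of the driving vector. -/
noncomputable def avgKernel (φ γ s : ℝ) (x z : Cube N) : ℂ :=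
  (Fintype.card (Equiv.Perm (Fin N)) : ℂ)⁻¹ * ∑ σ : Equiv.Perm (Fin N),
    ∑ y, (transProb φ γ (z ∘ σ) x y : ℂ) * Complex.exp (s * scaledNorm φ y * Complex.I)

lemma sum_transProb_mul_exp (hφ : φ ∈ Set.Ioo (0 : ℝ) 1) (hα : min φ γ = α) (s : ℝ)
    (x z : Cube N) :
    ∑ y, (transProb φ γ z x y : ℂ) * Complex.exp (s * scaledNorm φ y * Complex.I) =
      ∏ k, Complex.exp (-(s * φ / √N : ℝ) * Complex.I) *
        (1 + (jumpProb φ α (1 - bit (z k) / α) (1 - bit (x k) / γ) : ℂ) *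
          (Complex.exp ((s / √N : ℝ) * Complex.I) - 1)) := by
  have h1 := sum_transProb_mul_prod hφ hα z x fun b =>
    Complex.exp ((s * (bit b - φ) / √N : ℝ) * Complex.I)
  have h2 : ∀ y : Cube N, ∏ k, Complex.exp ((s * (bit (y k) - φ) / √N : ℝ) * Complex.I) =
      Complex.exp (s * scaledNorm φ y * Complex.I) := by
    intro y
    rw [← Complex.exp_sum, ← Finset.sum_mul, ← Complex.ofReal_sum, ← Complex.ofReal_mul]
    congr 3
    rw [scaledNorm, hammingNorm01_eq_sum, ← Finset.sum_div, ← Finset.mul_sum,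
      Finset.sum_sub_distrib]
    simp [mul_div_assoc]
  simp only [h2] at h1
  rw [h1]
  refine Finset.prod_congr rfl fun k _ => ?_
  have h3 : Complex.exp ((s * (bit true - φ) / √N : ℝ) * Complex.I) =
      Complex.exp (-(s * φ / √N : ℝ) * Complex.I) * Complex.exp ((s / √N : ℝ) * Complex.I) := by
    rw [← Complex.exp_add]
    congr 1
    simp only [bit, if_true]
    push_cast
    ring
  have h4 : Complex.exp ((s * (bit false - φ) / √N : ℝ) * Complex.I) =
      Complex.exp (-(s * φ / √N : ℝ) * Complex.I) := by
    congr 1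
    simp only [bit, Bool.false_eq_true, if_false]
    push_cast
    ring
  rw [h3, h4]
  ring

lemma norm_avgKernel_le_one (hφ : φ ∈ Set.Ioo (0 : ℝ) 1) (hγ : γ ∈ Set.Ioo (0 : ℝ) 1)
    (hsum : 1 ≤ φ + γ) (s : ℝ) (x z : Cube N) : ‖avgKernel φ γ s x z‖ ≤ 1 := by
  have h0 : (0 : ℝ) < Fintype.card (Equiv.Perm (Fin N)) := by exact_mod_cast Fintype.card_pos
  rw [avgKernel, norm_mul, norm_inv, Complex.norm_natCast, inv_mul_le_iff₀ h0, mul_one]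
  refine (norm_sum_le _ _).trans ?_
  calc _ ≤ ∑ _σ : Equiv.Perm (Fin N), (1 : ℝ) := Finset.sum_le_sum fun σ _ => by
        refine (norm_sum_le _ _).trans_eq ?_
        rw [← sum_transProb (γ := γ) hφ (z ∘ σ) x]
        refine Finset.sum_congr rfl fun y _ => ?_
        rw [norm_mul, Complex.norm_real, Real.norm_of_nonneg (transProb_nonneg hφ hγ hsum _ _ _),
          ← Complex.ofReal_mul, Complex.norm_exp_ofReal_mul_I, mul_one]
    _ = _ := by simp

end Transition

/-! ### From the averaged kernel to a Gaussian exponential -/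

section KernelLimit

variable {N : ℕ} {φ γ α : ℝ}

lemma abs_one_sub_bit_div_le (hα : 1 / 2 ≤ α) (b : Bool) : |1 - bit b / α| ≤ 1 := by
  have h1 := neg_le_one_sub_bit_div (α := α) (by linarith) b
  have h2 := one_sub_bit_div_le (α := α) (by linarith) b
  have h3 : (1 - α) / α ≤ 1 := by rw [div_le_one (by linarith)]; linarith
  exact abs_le.2 ⟨by linarith, h2⟩

lemma sum_one_sub_bit_div (γ : ℝ) (x : Cube N) :
    ∑ k, (1 - bit (x k) / γ) = N - hammingNorm01 x / γ := by
  rw [Finset.sum_sub_distrib, ← Finset.sum_div, hammingNorm01_eq_sum]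
  simp

lemma hammingNorm01_le (x : Cube N) : hammingNorm01 x ≤ N :=
  (Finset.card_filter_le _ _).trans_eq (by simp)

lemma hammingNorm01_eq_add (hN : 0 < N) (φ : ℝ) (x : Cube N) :
    (hammingNorm01 x : ℝ) = N * φ + √N * scaledNorm φ x := by
  have : √(N : ℝ) ≠ 0 := (Real.sqrt_pos.2 (by exact_mod_cast hN)).ne'
  unfold scaledNorm
  field_simp
  ring

lemma sum_one_sub_bit_div_eq (hN : 0 < N) (hγ : γ ≠ 0) (φ : ℝ) (x : Cube N) :
    ∑ k, (1 - bit (x k) / γ) = -(√N * (√N * (φ - γ) + scaledNorm φ x)) / γ := by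
  have h : √(N : ℝ) * √N = N := Real.mul_self_sqrt N.cast_nonneg
  rw [sum_one_sub_bit_div, hammingNorm01_eq_add hN φ]
  field_simp
  linear_combination (φ - γ) * h

/-- The characteristic function after one step, with the driving vector replaced by its mean. -/
noncomputable def meanKernel (φ γ α s q : ℝ) (x : Cube N) : ℂ :=
  ∏ k, (Complex.exp (-(s * φ / √N : ℝ) * Complex.I) *
    (1 + (jumpProb φ α q (1 - bit (x k) / γ) : ℂ) * (Complex.exp ((s / √N : ℝ) * Complex.I) - 1)))

lemma exists_norm_avgKernel_sub_meanKernel_le (s B : ℝ) :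
    ∃ D : ℝ, ∀ (N : ℕ) (φ γ α : ℝ) (x z : Cube N), 0 < N → φ ∈ Set.Ioo (0 : ℝ) 1 →
      γ ∈ Set.Ioo (0 : ℝ) 1 → min φ γ = α → 1 / 2 ≤ α → |√N * (φ - γ)| + |scaledNorm φ x| ≤ B →
      ‖avgKernel φ γ s x z - meanKernel φ γ α s (1 - hammingNorm01 z / N / α) x‖ ≤ D / N := by
  -- The sum of the g_k is at most √N * B / γ, and γ ≥ 1/2 gives the constant 2 * B. The summand 1
  -- in |s| + 1 only ensures positivity.
  obtain ⟨D, hD⟩ := exists_norm_permAvg_prod_sub_le (|s| + 1) (2 * B) (by positivity)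
  refine ⟨D, fun N φ γ α x z hN hφ hγ hα hα2 hB => ?_⟩
  have hα0 : 0 < α := by linarith
  have hαφ : α ≤ φ := hα ▸ min_le_left _ _
  have hαγ : α ≤ γ := hα ▸ min_le_right _ _
  have hα1 : 0 < 1 - α := by linarith [hφ.2]
  have hN' : (0 : ℝ) < N := by exact_mod_cast hN
  have hsq : 0 < √(N : ℝ) := Real.sqrt_pos.2 hN'
  have : Nonempty (Fin N) := ⟨⟨0, hN⟩⟩
  set e₀ := Complex.exp (-(s * φ / √N : ℝ) * Complex.I) with he₀
  set w := Complex.exp ((s / √N : ℝ) * Complex.I) with hw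
  have hne₀ : ‖e₀‖ = 1 := by
    rw [he₀, ← Complex.ofReal_neg, Complex.norm_exp_ofReal_mul_I]
  set κ := α / (1 - α) * (1 - φ) with hκ
  have hκ0 : 0 ≤ κ := mul_nonneg (by positivity) (by linarith [hφ.2])
  have hκ1 : κ ≤ 1 := by
    rw [hκ, div_mul_eq_mul_div, div_le_one hα1]
    nlinarith [hφ.2]
  -- Each factor is affine in the product u g, with slope containing w - 1 = O(N^{-1/2}): the shape
  -- required by the averaging estimate.
  have hfac : ∀ u g : ℝ, e₀ * (1 + (jumpProb φ α u g : ℂ) * (w - 1)) =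
      e₀ * (1 + (φ : ℂ) * (w - 1)) + (-(e₀ * κ * (w - 1))) * u * g := by
    intro u g
    have : (jumpProb φ α u g : ℂ) = φ - κ * u * g := by
      rw [hκ]; unfold jumpProb; push_cast; ring
    rw [this]
    ring
  have h := hD (Fin N) (e₀ * (1 + (φ : ℂ) * (w - 1))) (-(e₀ * κ * (w - 1)))
    (fun k => 1 - bit (x k) / γ) (fun k => 1 - bit (z k) / α) ?_ ?_
    (fun k => abs_one_sub_bit_div_le hα2 _)
    (fun k => abs_one_sub_bit_div_le (by linarith) _) ?_
  · simp only [← hfac, sum_one_sub_bit_div, Fintype.card_fin] at h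
    have hq : ((N : ℝ) - hammingNorm01 z / α) / N = 1 - hammingNorm01 z / N / α := by
      field_simp
    rw [hq] at h
    rw [avgKernel, meanKernel]
    simp_rw [sum_transProb_mul_exp hφ hα]
    exact h
  · rw [norm_mul, hne₀, one_mul, hw]
    exact norm_one_add_mul_exp_sub_one_le ⟨hφ.1.le, hφ.2.le⟩ _
  · rw [norm_neg, norm_mul, norm_mul, hne₀, one_mul, Complex.norm_real, Real.norm_of_nonneg hκ0,
      Fintype.card_fin]
    have h1 : ‖w - 1‖ ≤ |s| / √N := by
      have := Real.norm_exp_I_mul_ofReal_sub_one_le (x := s / √N)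
      rw [mul_comm Complex.I] at this
      rwa [Real.norm_eq_abs, abs_div, abs_of_pos hsq] at this
    calc κ * ‖w - 1‖ ≤ 1 * (|s| / √N) := by gcongr
      _ ≤ _ := by rw [one_mul]; gcongr; linarith
  · rw [sum_one_sub_bit_div_eq hN hγ.1.ne' φ, Fintype.card_fin, abs_div, abs_neg, abs_mul,
      abs_of_pos hsq, abs_of_pos hγ.1, div_le_iff₀ hγ.1]
    have h1 : |√N * (φ - γ) + scaledNorm φ x| ≤ B := (abs_add_le _ _).trans hB
    have h2 : 0 ≤ B := (abs_nonneg _).trans h1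
    calc √N * |√N * (φ - γ) + scaledNorm φ x| ≤ √N * B := by gcongr
      _ ≤ 2 * B * √N * γ := by
        have : 0 ≤ √(N : ℝ) * B := by positivity
        nlinarith

/-- N independent factors, each replaced at cost 5|s/√N|³. -/
lemma norm_meanKernel_sub_exp_le (hN : 0 < N) (hφ : φ ∈ Set.Ioo (0 : ℝ) 1)
    (hγ : γ ∈ Set.Ioo (0 : ℝ) 1) (hsum : 1 ≤ φ + γ) (hα : min φ γ = α) {s q : ℝ}
    (hq : -((1 - α) / α) ≤ q) (hq1 : q ≤ 1) (hs : |s| / √N ≤ 1 / 2) (x : Cube N) :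
    ‖meanKernel φ γ α s q x - Complex.exp
      (((s * ∑ k, (jumpProb φ α q (1 - bit (x k) / γ) - φ) / √N : ℝ) : ℂ) * Complex.I -
        ((s ^ 2 / 2 * ∑ k, jumpProb φ α q (1 - bit (x k) / γ) *
          (1 - jumpProb φ α q (1 - bit (x k) / γ)) / N : ℝ) : ℂ))‖ ≤ 5 * |s| ^ 3 / √N := by
  have hN' : (0 : ℝ) < N := by exact_mod_cast hN
  have hsq : 0 < √(N : ℝ) := Real.sqrt_pos.2 hN'
  have hsq2 : √(N : ℝ) ^ 2 = N := Real.sq_sqrt hN'.le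
  set p : Fin N → ℝ := fun k => jumpProb φ α q (1 - bit (x k) / γ) with hp
  have hp01 : ∀ k, p k ∈ Set.Icc (0 : ℝ) 1 := fun k =>
    jumpProb_mem_Icc hφ hγ hsum hα hq hq1 (one_sub_bit_div_eq γ (x k))
  set e₀ := Complex.exp (-(s * φ / √N : ℝ) * Complex.I) with he₀
  have hne₀ : ‖e₀‖ = 1 := by
    rw [he₀, ← Complex.ofReal_neg, Complex.norm_exp_ofReal_mul_I]
  set t := s / √N with ht
  have hexp : Complex.exp (((s * ∑ k, (p k - φ) / √N : ℝ) : ℂ) * Complex.I -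
        ((s ^ 2 / 2 * ∑ k, p k * (1 - p k) / N : ℝ) : ℂ)) =
      ∏ k, (e₀ * Complex.exp (p k * t * Complex.I - p k * (1 - p k) * t ^ 2 / 2)) := by
    rw [he₀]
    simp_rw [← Complex.exp_add]
    rw [← Complex.exp_sum]
    congr 1
    rw [Finset.mul_sum, Finset.mul_sum]
    push_cast
    rw [Finset.sum_mul, ← Finset.sum_sub_distrib]
    refine Finset.sum_congr rfl fun k _ => ?_
    have : (N : ℂ) = ((√N : ℝ) : ℂ) ^ 2 := by rw [← Complex.ofReal_pow, hsq2]; simp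
    rw [this, ht]
    have hne : ((√N : ℝ) : ℂ) ≠ 0 := by exact_mod_cast hsq.ne'
    push_cast
    field_simp
    ring
  have hta : |t| = |s| / √N := by rw [ht, abs_div, abs_of_pos hsq]
  change ‖∏ k, (e₀ * (1 + (p k : ℂ) * (Complex.exp (t * Complex.I) - 1))) - Complex.exp
      (((s * ∑ k, (p k - φ) / √N : ℝ) : ℂ) * Complex.I -
        ((s ^ 2 / 2 * ∑ k, p k * (1 - p k) / N : ℝ) : ℂ))‖ ≤ _
  rw [hexp]
  refine (norm_prod_sub_prod_le _ (fun k => ?_) fun k => ?_).trans ?_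
  · rw [norm_mul, hne₀, one_mul]
    exact norm_one_add_mul_exp_sub_one_le (hp01 k) t
  · rw [norm_mul, hne₀, one_mul, Complex.norm_exp, Real.exp_le_one_iff]
    have : ((p k : ℂ) * t * Complex.I - p k * (1 - p k) * t ^ 2 / 2) =
      ((-(p k * (1 - p k) * t ^ 2 / 2) : ℝ) : ℂ) + ((p k * t : ℝ) : ℂ) * Complex.I := by
      push_cast; ring
    rw [this, Complex.add_re, Complex.re_ofReal_mul, Complex.I_re, Complex.ofReal_re, mul_zero,
      add_zero]
    have h1 := (hp01 k).1
    have h2 : 0 ≤ 1 - p k := by linarith [(hp01 k).2]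
    have : 0 ≤ p k * (1 - p k) * t ^ 2 / 2 := by positivity
    linarith
  · calc _ ≤ ∑ _k : Fin N, 5 * |t| ^ 3 := Finset.sum_le_sum fun k _ => by
          rw [← mul_sub, norm_mul, hne₀, one_mul]
          exact norm_bernoulli_charFun_sub_le (hp01 k) (by rw [hta]; exact hs)
      _ = 5 * |s| ^ 3 / √N := by
          rw [Finset.sum_const, Finset.card_univ, Fintype.card_fin, nsmul_eq_mul, hta]
          nth_rewrite 1 [← hsq2]
          field_simp

lemma sum_jumpProb_sub (hN : 0 < N) (hγ : γ ≠ 0) (q : ℝ) (x : Cube N) :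
    ∑ k, (jumpProb φ α q (1 - bit (x k) / γ) - φ) / √N =
      α / (1 - α) * (1 - φ) / γ * q * (√N * (φ - γ) + scaledNorm φ x) := by
  have hsq : √(N : ℝ) ≠ 0 := (Real.sqrt_pos.2 (by exact_mod_cast hN)).ne'
  have h : ∀ k, (jumpProb φ α q (1 - bit (x k) / γ) - φ) / √N =
      -(α / (1 - α) * (1 - φ) * q / √N) * (1 - bit (x k) / γ) := by
    intro k; unfold jumpProb; ring
  rw [Finset.sum_congr rfl fun k _ => h k, ← Finset.mul_sum, sum_one_sub_bit_div_eq hN hγ φ]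
  generalize α / (1 - α) = κ
  field_simp

/-- The square of a bit is the bit itself, so the quadratic expression in x[k] is affine and its sum
depends on x only through the norm. -/
lemma sum_jumpProb_mul_one_sub (hN : 0 < N) (hγ : γ ≠ 0) (q : ℝ) (x : Cube N) :
    ∑ k, jumpProb φ α q (1 - bit (x k) / γ) * (1 - jumpProb φ α q (1 - bit (x k) / γ)) / N =
      φ * (1 - φ) + α / (1 - α) * (1 - φ) / γ * (1 - 2 * φ) * q *
          ((√N * (φ - γ) + scaledNorm φ x) / √N) -
        (α / (1 - α) * (1 - φ)) ^ 2 * q ^ 2 *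
          (1 - (φ + scaledNorm φ x / √N) * (2 / γ - 1 / γ ^ 2)) := by
  have hN' : (0 : ℝ) < N := by exact_mod_cast hN
  have hsq : 0 < √(N : ℝ) := Real.sqrt_pos.2 hN'
  have hsq2 : √(N : ℝ) ^ 2 = N := Real.sq_sqrt hN'.le
  have hb : ∀ b : Bool, bit b ^ 2 = bit b := fun b => by cases b <;> simp [bit]
  set κ := α / (1 - α) * (1 - φ) with hκ
  have h : ∀ k, jumpProb φ α q (1 - bit (x k) / γ) * (1 - jumpProb φ α q (1 - bit (x k) / γ)) / N
      = φ * (1 - φ) / N - κ * q * (1 - 2 * φ) / N * (1 - bit (x k) / γ) -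
        κ ^ 2 * q ^ 2 / N * (1 - (2 / γ - 1 / γ ^ 2) * bit (x k)) := by
    intro k
    unfold jumpProb
    rw [← hκ]
    linear_combination (-(κ ^ 2 * q ^ 2 / γ ^ 2 / N)) * hb (x k)
  rw [Finset.sum_congr rfl fun k _ => h k, Finset.sum_sub_distrib, Finset.sum_sub_distrib,
    ← Finset.mul_sum, ← Finset.mul_sum, sum_one_sub_bit_div_eq hN hγ φ, Finset.sum_sub_distrib,
    ← Finset.mul_sum, ← hammingNorm01_eq_sum, hammingNorm01_eq_add hN φ]
  simp only [Finset.sum_const, Finset.card_univ, Fintype.card_fin, nsmul_eq_mul, mul_one]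
  rw [← hsq2, Real.sqrt_sq hsq.le]
  field_simp
  ring

end KernelLimit

/-! ### The limiting Gaussian transition -/

/-- The characteristic function of the limiting transition: the normal law with mean
`(1 - θ/α)(v + c)` and variance `α(1-α)(1-(1-θ/α)²)`. -/
noncomputable def limKernel (α c s v θ : ℝ) : ℂ :=
  Complex.exp (((s * ((1 - θ / α) * (v + c)) : ℝ) : ℂ) * Complex.I -
    ((s ^ 2 / 2 * (innovVar α θ).toNNReal : ℝ) : ℂ))

lemma charFun_gaussianReal_eq_limKernel (α c s v θ : ℝ) :
    charFun (gaussianReal ((1 - θ / α) * (v + c)) (innovVar α θ).toNNReal) s =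
      limKernel α c s v θ := by
  rw [charFun_gaussianReal, limKernel]
  congr 1
  push_cast
  ring

lemma re_ofReal_mul_I_sub (a b : ℝ) : ((a : ℂ) * Complex.I - (b : ℂ)).re = -b := by
  simp

lemma norm_limKernel_le_one (α c s v θ : ℝ) : ‖limKernel α c s v θ‖ ≤ 1 := by
  rw [limKernel, Complex.norm_exp, Real.exp_le_one_iff, re_ofReal_mul_I_sub, neg_nonpos]
  positivity

lemma continuous_limKernel {E : Type*} [TopologicalSpace E] (α c s : ℝ) {v θ : E → ℝ}
    (hv : Continuous v) (hθ : Continuous θ) : Continuous fun u => limKernel α c s (v u) (θ u) := by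
  unfold limKernel innovVar
  fun_prop

section KernelLimit

variable {N : ℕ} {φ γ α c : ℝ}

/-- The bound contains neither x nor θ, only M, and each of its terms vanishes as N grows; hence the
uniformity of the kernel limit. -/
lemma norm_exp_moments_sub_limKernel_le (hN : 0 < N) (hφ : φ ∈ Set.Ioo (0 : ℝ) 1)
    (hγ : γ ∈ Set.Ioo (0 : ℝ) 1) (hsum : 1 ≤ φ + γ) (hα : min φ γ = α) (hα2 : 1 / 2 ≤ α)
    {s θ M : ℝ} (hθ : θ ∈ Set.Icc (0 : ℝ) 1) (x : Cube N) (hM : |scaledNorm φ x| ≤ M) :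
    ‖Complex.exp
      (((s * ∑ k, (jumpProb φ α (1 - θ / α) (1 - bit (x k) / γ) - φ) / √N : ℝ) : ℂ) * Complex.I -
        ((s ^ 2 / 2 * ∑ k, jumpProb φ α (1 - θ / α) (1 - bit (x k) / γ) *
          (1 - jumpProb φ α (1 - θ / α) (1 - bit (x k) / γ)) / N : ℝ) : ℂ)) -
      limKernel α c s (scaledNorm φ x) θ‖ ≤
    |s| * (|α / (1 - α) * (1 - φ) / γ * (√N * (φ - γ)) - c| +
      |α / (1 - α) * (1 - φ) / γ - 1| * M) +
    s ^ 2 / 2 * (|φ * (1 - φ) - α * (1 - α)| +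
      |α / (1 - α) * (1 - φ) / γ| * ((|√N * (φ - γ)| + M) / √N) +
      |(α / (1 - α) * (1 - φ)) ^ 2 * (1 - φ * (2 / γ - 1 / γ ^ 2)) - α * (1 - α)| +
      |(α / (1 - α) * (1 - φ)) ^ 2 * (2 / γ - 1 / γ ^ 2)| * (M / √N)) := by
  have hα0 : 0 < α := by linarith
  have hαφ : α ≤ φ := hα ▸ min_le_left _ _
  have hα1 : 0 < 1 - α := by linarith [hφ.2]
  have hsq : 0 < √(N : ℝ) := Real.sqrt_pos.2 (by exact_mod_cast hN)
  have hq1 : 1 - θ / α ≤ 1 := by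
    have := div_nonneg hθ.1 hα0.le
    linarith
  have hq0 : -((1 - α) / α) ≤ 1 - θ / α := by
    rw [sub_div, div_self hα0.ne']
    have : θ / α ≤ 1 / α := by gcongr; exact hθ.2
    linarith
  have hq : |1 - θ / α| ≤ 1 := by
    have h3 : (1 - α) / α ≤ 1 := by rw [div_le_one hα0]; linarith
    exact abs_le.2 ⟨by linarith, hq1⟩
  have hvar0 : 0 ≤ innovVar α θ := by
    unfold innovVar
    have : (1 - θ / α) ^ 2 ≤ 1 := (sq_le_one_iff_abs_le_one _).2 hq
    have : 0 ≤ 1 - (1 - θ / α) ^ 2 := by linarith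
    positivity
  have hnn : 0 ≤ ∑ k, jumpProb φ α (1 - θ / α) (1 - bit (x k) / γ) *
      (1 - jumpProb φ α (1 - θ / α) (1 - bit (x k) / γ)) / N := by
    refine Finset.sum_nonneg fun k _ => ?_
    have h := jumpProb_mem_Icc hφ hγ hsum hα hq0 hq1 (one_sub_bit_div_eq γ (x k))
    have h2 := sub_nonneg.2 h.2
    have h1 := h.1
    positivity
  rw [limKernel]
  refine (norm_exp_sub_exp_le ?_ ?_).trans ?_
  · rw [re_ofReal_mul_I_sub, neg_nonpos]; positivity
  · rw [re_ofReal_mul_I_sub, neg_nonpos]; positivity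
  rw [sum_jumpProb_sub hN hγ.1.ne', sum_jumpProb_mul_one_sub hN hγ.1.ne', Real.coe_toNNReal _ hvar0,
    innovVar]
  set q := 1 - θ / α
  set v := scaledNorm φ x
  set κ := α / (1 - α) * (1 - φ)
  set ρ := κ / γ
  set cN := √N * (φ - γ)
  set h := 2 / γ - 1 / γ ^ 2
  have e : ∀ a b a' b' : ℝ, ((a : ℂ) * Complex.I - (b : ℂ)) - ((a' : ℂ) * Complex.I - (b' : ℂ)) =
      ((a - a' : ℝ) : ℂ) * Complex.I - ((b - b' : ℝ) : ℂ) := by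
    intro a b a' b'; push_cast; ring
  rw [e]
  refine (norm_sub_le _ _).trans ?_
  rw [norm_mul, Complex.norm_I, mul_one, Complex.norm_real, Complex.norm_real, Real.norm_eq_abs,
    Real.norm_eq_abs, ← mul_sub, ← mul_sub, abs_mul, abs_mul,
    abs_of_nonneg (show (0 : ℝ) ≤ s ^ 2 / 2 by positivity)]
  have hM0 : 0 ≤ M := (abs_nonneg _).trans hM
  have hmul : ∀ a : ℝ, |q * a| ≤ |a| := fun a => by
    rw [abs_mul]; exact mul_le_of_le_one_left (abs_nonneg _) hq
  have hv : |v / √N| ≤ M / √N := by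
    rw [abs_div, abs_of_pos hsq]; gcongr
  gcongr |s| * ?_ + s ^ 2 / 2 * ?_
  · have e1 : ρ * q * (cN + v) - q * (v + c) = q * ((ρ * cN - c) + (ρ - 1) * v) := by ring
    rw [e1]
    refine (hmul _).trans ((abs_add_le _ _).trans ?_)
    rw [abs_mul]
    gcongr
  -- Every term depending on θ carries a factor q, which |q| ≤ 1 removes from the bound.
  · have e2 : φ * (1 - φ) + ρ * (1 - 2 * φ) * q * ((cN + v) / √N) -
        κ ^ 2 * q ^ 2 * (1 - (φ + v / √N) * h) - α * (1 - α) * (1 - q ^ 2) =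
      (φ * (1 - φ) - α * (1 - α)) + q * ((1 - 2 * φ) * (ρ * ((cN + v) / √N))) +
        q * (q * -(κ ^ 2 * (1 - φ * h) - α * (1 - α))) + q * (q * (κ ^ 2 * h * (v / √N))) := by
      ring
    rw [e2]
    refine (abs_add_le _ _).trans (add_le_add ((abs_add_le _ _).trans
      (add_le_add ((abs_add_le _ _).trans (add_le_add le_rfl ?_)) ?_)) ?_)
    · refine (hmul _).trans ?_
      rw [abs_mul, abs_mul, abs_div (cN + v), abs_of_pos hsq]
      have h1 : |1 - 2 * φ| ≤ 1 := abs_le.2 ⟨by linarith [hφ.2], by linarith [hφ.1]⟩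
      refine (mul_le_of_le_one_left (by positivity) h1).trans ?_
      gcongr
      exact (abs_add_le _ _).trans (by gcongr)
    · exact (hmul _).trans ((hmul _).trans (abs_neg _).le)
    · refine (hmul _).trans ((hmul _).trans ?_)
      rw [abs_mul]
      gcongr

end KernelLimit

/-! ### Locally uniform limit of the one-step characteristic functions -/

section Limit

variable {α c : ℝ} {φ γ : ℕ → ℝ}

lemma tendsto_sub_zero_of_tendsto_sqrt_mul
    (hc : Tendsto (fun N : ℕ => √N * (φ N - γ N)) atTop (𝓝 c)) :
    Tendsto (fun N => φ N - γ N) atTop (𝓝 0) := by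
  have h1 : Tendsto (fun N : ℕ => (√(N : ℝ))⁻¹) atTop (𝓝 0) :=
    tendsto_inv_atTop_zero.comp (Real.tendsto_sqrt_atTop.comp tendsto_natCast_atTop_atTop)
  have h2 := h1.mul hc
  rw [zero_mul] at h2
  refine h2.congr' ?_
  filter_upwards [eventually_gt_atTop 0] with N hN
  have : √(N : ℝ) ≠ 0 := (Real.sqrt_pos.2 (by exact_mod_cast hN)).ne'
  field_simp

lemma tendsto_params (hα : ∀ N, min (φ N) (γ N) = α)
    (hc : Tendsto (fun N : ℕ => √N * (φ N - γ N)) atTop (𝓝 c)) :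
    Tendsto φ atTop (𝓝 α) ∧ Tendsto γ atTop (𝓝 α) := by
  have h0 := (tendsto_sub_zero_of_tendsto_sqrt_mul hc).abs
  rw [abs_zero] at h0
  constructor
  all_goals
    rw [tendsto_iff_norm_sub_tendsto_zero]
    refine squeeze_zero (fun _ => norm_nonneg _) (fun N => ?_) h0
    rw [← hα N, Real.norm_eq_abs]
    rcases le_total (φ N) (γ N) with h | h
    · simp [h, abs_sub_comm]
    · simp [h]

/-- Both parameters tend to α while their sum stays at least 1. This is the source of |1 - z[k]/α| ≤
1 and of |1 - θ/α| ≤ 1 for θ in [0,1]. -/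
lemma half_le_of_params (hsum : ∀ N, 1 ≤ φ N + γ N) (hα : ∀ N, min (φ N) (γ N) = α)
    (hc : Tendsto (fun N : ℕ => √N * (φ N - γ N)) atTop (𝓝 c)) : 1 / 2 ≤ α := by
  obtain ⟨h1, h2⟩ := tendsto_params hα hc
  have := ge_of_tendsto' (h1.add h2) hsum
  linarith

/-- Locally uniform convergence of the averaged one-step characteristic functions. -/
theorem eventually_norm_avgKernel_sub_limKernel_le
    (hφ : ∀ N, φ N ∈ Set.Ioo (0 : ℝ) 1) (hγ : ∀ N, γ N ∈ Set.Ioo (0 : ℝ) 1)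
    (hsum : ∀ N, 1 ≤ φ N + γ N) (hα : ∀ N, min (φ N) (γ N) = α)
    (hc : Tendsto (fun N : ℕ => √N * (φ N - γ N)) atTop (𝓝 c)) (s M : ℝ) {ε : ℝ} (hε : 0 < ε) :
    ∀ᶠ N in atTop, ∀ x z : Cube N, |scaledNorm (φ N) x| ≤ M →
      ‖avgKernel (φ N) (γ N) s x z -
        limKernel α c s (scaledNorm (φ N) x) ((hammingNorm01 z : ℝ) / N)‖ ≤ ε := by
  obtain ⟨hφα, hγα⟩ := tendsto_params hα hc
  have hα2 := half_le_of_params hsum hα hc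
  have hα0 : 0 < α := by linarith
  have hα1 : 0 < 1 - α := by
    have : α ≤ φ 0 := hα 0 ▸ min_le_left _ _
    linarith [(hφ 0).2]
  obtain ⟨D, hD⟩ := exists_norm_avgKernel_sub_meanKernel_le s (|c| + 1 + M)
  have hsqrt : Tendsto (fun N : ℕ => √(N : ℝ)) atTop atTop :=
    Real.tendsto_sqrt_atTop.comp tendsto_natCast_atTop_atTop
  have hκ : Tendsto (fun N => α / (1 - α) * (1 - φ N)) atTop (𝓝 α) := by
    have := (hφα.const_sub 1).const_mul (α / (1 - α))
    rwa [div_mul_cancel₀ _ hα1.ne'] at this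
  have hρ : Tendsto (fun N => α / (1 - α) * (1 - φ N) / γ N) atTop (𝓝 1) := by
    have := hκ.div hγα hα0.ne'
    rwa [div_self hα0.ne'] at this
  have hh : Tendsto (fun N => 2 / γ N - 1 / γ N ^ 2) atTop (𝓝 (2 / α - 1 / α ^ 2)) :=
    (tendsto_const_nhds.div hγα hα0.ne').sub
      (tendsto_const_nhds.div (hγα.pow 2) (pow_ne_zero 2 hα0.ne'))
  have herr : Tendsto (fun N : ℕ => D / N + 5 * |s| ^ 3 / √N +
    (|s| * (|α / (1 - α) * (1 - φ N) / γ N * (√N * (φ N - γ N)) - c| +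
      |α / (1 - α) * (1 - φ N) / γ N - 1| * M) +
    s ^ 2 / 2 * (|φ N * (1 - φ N) - α * (1 - α)| +
      |α / (1 - α) * (1 - φ N) / γ N| * ((|√N * (φ N - γ N)| + M) / √N) +
      |(α / (1 - α) * (1 - φ N)) ^ 2 * (1 - φ N * (2 / γ N - 1 / γ N ^ 2)) - α * (1 - α)| +
      |(α / (1 - α) * (1 - φ N)) ^ 2 * (2 / γ N - 1 / γ N ^ 2)| * (M / √N)))) atTop (𝓝 0) := by
    have t1 : Tendsto (fun N : ℕ => D / N) atTop (𝓝 0) :=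
      tendsto_const_nhds.div_atTop tendsto_natCast_atTop_atTop
    have t2 : Tendsto (fun N : ℕ => 5 * |s| ^ 3 / √N) atTop (𝓝 0) :=
      tendsto_const_nhds.div_atTop hsqrt
    have t3 := ((hρ.mul hc).sub_const c).abs
    have t4 := ((hρ.sub_const 1).abs).mul_const M
    have t5 := ((hφα.mul (hφα.const_sub 1)).sub_const (α * (1 - α))).abs
    have t6 := hρ.abs.mul ((hc.abs.add_const M).div_atTop hsqrt)
    have t7 := (((hκ.pow 2).mul ((hφα.mul hh).const_sub 1)).sub_const (α * (1 - α))).abs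
    have t8 := ((hκ.pow 2).mul hh).abs.mul
      ((tendsto_const_nhds (x := M)).div_atTop hsqrt)
    have t := (t1.add t2).add (((t3.add t4).const_mul |s|).add
      ((((t5.add t6).add t7).add t8).const_mul (s ^ 2 / 2)))
    convert! t using 2
    -- The limit of the coefficient of q² in the variance is exactly α(1-α).
    have : α ^ 2 * (1 - α * (2 / α - 1 / α ^ 2)) - α * (1 - α) = 0 := by field_simp; ring
    rw [this]
    simp
  have hcb : ∀ᶠ N : ℕ in atTop, |√N * (φ N - γ N)| < |c| + 1 :=
    hc.abs.eventually_lt_const (by linarith)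
  have hsb : ∀ᶠ N : ℕ in atTop, |s| / √(N : ℝ) < 1 / 2 :=
    (tendsto_const_nhds.div_atTop hsqrt).eventually_lt_const (by norm_num)
  filter_upwards [eventually_gt_atTop 0, hcb, hsb, herr.eventually_lt_const hε]
    with N hN hcN hsN hεN x z hx
  have hN' : (0 : ℝ) < N := by exact_mod_cast hN
  have hθ : (hammingNorm01 z : ℝ) / N ∈ Set.Icc (0 : ℝ) 1 :=
    ⟨by positivity, by rw [div_le_one hN']; exact_mod_cast hammingNorm01_le z⟩
  have hq1 : 1 - (hammingNorm01 z : ℝ) / N / α ≤ 1 := by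
    have := div_nonneg hθ.1 hα0.le
    linarith
  have hq0 : -((1 - α) / α) ≤ 1 - (hammingNorm01 z : ℝ) / N / α := by
    rw [sub_div, div_self hα0.ne']
    have : (hammingNorm01 z : ℝ) / N / α ≤ 1 / α := by gcongr; exact hθ.2
    linarith
  have h1 := hD N (φ N) (γ N) α x z hN (hφ N) (hγ N) (hα N) hα2 (by linarith)
  have h2 := norm_meanKernel_sub_exp_le hN (hφ N) (hγ N) (hsum N) (hα N) hq0 hq1 hsN.le x
  have h3 := norm_exp_moments_sub_limKernel_le (c := c) (s := s) hN (hφ N) (hγ N) (hsum N) (hα N)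
    hα2 hθ x hx
  have h4 := norm_sub_le_norm_sub_add_norm_sub (avgKernel (φ N) (γ N) s x z)
    (meanKernel (φ N) (γ N) α s (1 - hammingNorm01 z / N / α) x)
    (limKernel α c s (scaledNorm (φ N) x) ((hammingNorm01 z : ℝ) / N))
  refine h4.trans ((add_le_add h1 ((norm_sub_le_norm_sub_add_norm_sub _ _ _).trans
    (add_le_add h2 h3))).trans ?_)
  linarith

end Limit

/-! ### Conditioning on finite-valued variables -/

section FiniteValued

variable {Ω : Type*} [MeasurableSpace Ω] {P : Measure Ω} [IsProbabilityMeasure P]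

lemma integral_comp_eq_sum {S : Type*} [Fintype S] [MeasurableSpace S] [MeasurableSingletonClass S]
    {W : Ω → S} (hW : Measurable W) (f : S → ℂ) :
    ∫ ω, f (W ω) ∂P = ∑ s, P.real {ω | W ω = s} • f s := by
  rw [← integral_map (φ := W) (f := f) hW.aemeasurable (Measurable.of_discrete).aestronglyMeasurable,
    integral_fintype (Integrable.of_finite)]
  refine Finset.sum_congr rfl fun s _ => ?_
  rw [map_measureReal_apply hW (measurableSet_singleton s)]
  rfl

variable {S R : Type*} [Fintype S] [MeasurableSpace S] [MeasurableSingletonClass S]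
  [Fintype R] [MeasurableSpace R] [MeasurableSingletonClass R]
  {U : Ω → S} {Z Y : Ω → R} {ζ : Measure R} {p : S → R → R → ℝ}

/-- U stands for the whole past. All spaces of values are finite, so conditioning reduces to sums
over atoms. -/
lemma integral_comp_of_step (hU : Measurable U) (hZ : Measurable Z) (hY : Measurable Y)
    (h : ∀ s z y, P.real {ω | U ω = s ∧ Z ω = z ∧ Y ω = y} =
      P.real {ω | U ω = s} * (ζ.real {z} * p s z y)) (F : S → R → R → ℂ) :
    ∫ ω, F (U ω) (Z ω) (Y ω) ∂P =
      ∫ ω, ∑ z, (ζ.real {z} : ℂ) * ∑ y, (p (U ω) z y : ℂ) * F (U ω) z y ∂P := by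
  rw [integral_comp_eq_sum (W := fun ω => (U ω, Z ω, Y ω)) (hU.prodMk (hZ.prodMk hY))
    (fun w => F w.1 w.2.1 w.2.2), integral_comp_eq_sum hU
    (fun s => ∑ z, (ζ.real {z} : ℂ) * ∑ y, (p s z y : ℂ) * F s z y), Fintype.sum_prod_type]
  refine Finset.sum_congr rfl fun s _ => ?_
  rw [Fintype.sum_prod_type, Finset.smul_sum]
  refine Finset.sum_congr rfl fun z _ => ?_
  rw [Finset.mul_sum, Finset.smul_sum]
  refine Finset.sum_congr rfl fun y _ => ?_
  simp only [Prod.mk.injEq]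
  rw [h]
  simp only [Complex.real_smul]
  push_cast
  ring

lemma integral_comp_of_step_of_sum_eq_one (hU : Measurable U) (hZ : Measurable Z)
    (hY : Measurable Y)
    (h : ∀ s z y, P.real {ω | U ω = s ∧ Z ω = z ∧ Y ω = y} =
      P.real {ω | U ω = s} * (ζ.real {z} * p s z y)) (hp : ∀ s z, ∑ y, p s z y = 1)
    (F : S → R → ℂ) :
    ∫ ω, F (U ω) (Z ω) ∂P = ∫ ω, ∑ z, (ζ.real {z} : ℂ) * F (U ω) z ∂P := by
  rw [integral_comp_of_step hU hZ hY h fun s z _ => F s z]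
  refine integral_congr_ae (ae_of_all _ fun ω => Finset.sum_congr rfl fun z _ => ?_)
  rw [← Finset.sum_mul, ← Complex.ofReal_sum, hp, Complex.ofReal_one, one_mul]

/-- Summing out y gives P(U = s, Z = z) = P(U = s) ζ{z}; summing out s then identifies ζ as the law
of Z. -/
lemma indepFun_of_step [IsProbabilityMeasure ζ] (hU : Measurable U) (hZ : Measurable Z)
    (hY : Measurable Y)
    (h : ∀ s z y, P.real {ω | U ω = s ∧ Z ω = z ∧ Y ω = y} =
      P.real {ω | U ω = s} * (ζ.real {z} * p s z y)) (hp : ∀ s z, ∑ y, p s z y = 1) :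
    IndepFun U Z P := by
  classical
  have hreal : ∀ A : Set Ω, MeasurableSet A →
      ∫ ω, A.indicator (fun _ => (1 : ℂ)) ω ∂P = P.real A := fun A hA => by
    rw [integral_indicator hA, setIntegral_const]; simp
  have h1 : ∀ s z, P.real {ω | U ω = s ∧ Z ω = z} = P.real {ω | U ω = s} * ζ.real {z} := by
    intro s z
    have h2 := integral_comp_of_step_of_sum_eq_one hU hZ hY h hp
      (fun s' z' => if s' = s ∧ z' = z then 1 else 0)
    have h3 : ∀ ω, ∑ z', (ζ.real {z'} : ℂ) * (if U ω = s ∧ z' = z then (1 : ℂ) else 0) =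
        {ω | U ω = s}.indicator (fun _ => (1 : ℂ)) ω * ζ.real {z} := by
      intro ω
      by_cases hs : U ω = s <;> simp [hs, Set.indicator]
    simp_rw [h3] at h2
    rw [integral_mul_const, hreal {ω | U ω = s} (hU (measurableSet_singleton s))] at h2
    have h4 : ∀ ω, (if U ω = s ∧ Z ω = z then (1 : ℂ) else 0) =
        {ω | U ω = s ∧ Z ω = z}.indicator (fun _ => (1 : ℂ)) ω := fun ω => by
      simp [Set.indicator]
    simp_rw [h4] at h2
    rw [hreal {ω | U ω = s ∧ Z ω = z} ((hU (measurableSet_singleton s)).inter (hZ (measurableSet_singleton z)))] at h2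
    exact_mod_cast h2
  have hZlaw : ∀ z, P.real {ω | Z ω = z} = ζ.real {z} := by
    intro z
    have h2 : ∑ s, P.real {ω | U ω = s ∧ Z ω = z} = P.real {ω | Z ω = z} := by
      rw [← measureReal_biUnion_finset]
      · congr 1; ext ω; simp
      · intro s _ s' _ hss
        refine Set.disjoint_left.2 fun ω h3 h4 => hss (h3.1.symm.trans h4.1)
      · exact fun s _ => (hU (measurableSet_singleton s)).inter (hZ (measurableSet_singleton z))
    have h3 : ∑ s, P.real {ω | U ω = s} = 1 := by
      rw [← measureReal_biUnion_finset]
      · rw [← probReal_univ (μ := P)]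
        congr 1; ext ω; simp
      · intro s _ s' _ hss
        exact Set.disjoint_left.2 fun ω h3 h4 => hss (h3.symm.trans h4)
      · exact fun s _ => hU (measurableSet_singleton s)
    rw [← h2]
    simp_rw [h1]
    rw [← Finset.sum_mul, h3, one_mul]
  rw [indepFun_iff_map_prod_eq_prod_map_map hU.aemeasurable hZ.aemeasurable]
  have := Measure.isProbabilityMeasure_map (μ := P) hU.aemeasurable
  have := Measure.isProbabilityMeasure_map (μ := P) hZ.aemeasurable
  have := Measure.isProbabilityMeasure_map (μ := P) (hU.prodMk hZ).aemeasurable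
  refine Measure.ext_of_singleton fun ⟨s, z⟩ => ?_
  rw [← Set.singleton_prod_singleton, Measure.prod_prod, Set.singleton_prod_singleton,
    ← ENNReal.toReal_eq_toReal_iff' (measure_ne_top _ _)
      (ENNReal.mul_ne_top (measure_ne_top _ _) (measure_ne_top _ _)), ENNReal.toReal_mul,
    ← measureReal_def, ← measureReal_def, ← measureReal_def,
    map_measureReal_apply hU (measurableSet_singleton _),
    map_measureReal_apply hZ (measurableSet_singleton _),
    map_measureReal_apply (hU.prodMk hZ) (measurableSet_singleton _)]
  have e1 := h1 s z
  rw [← hZlaw] at e1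
  simpa [Set.preimage, Prod.ext_iff] using e1

end FiniteValued

/-! ### The driven walk: Markov step and exchangeability -/

section Walk

variable {N : ℕ} {Ω : Type*} [MeasurableSpace Ω] {φ γ : ℝ} {ζ : Measure (Cube N)}
  [IsProbabilityMeasure ζ] {P : Measure Ω} [IsProbabilityMeasure P] {X Z : ℕ → Ω → Cube N}

/-- The path of the walk and of its driving variables up to time `T`. -/
def walkPath (X Z : ℕ → Ω → Cube N) (T : ℕ) (ω : Ω) :
    (Fin (T + 1) → Cube N) × (Fin T → Cube N) :=
  (fun t => X t ω, fun t => Z (t + 1) ω)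

omit [IsProbabilityMeasure ζ] [IsProbabilityMeasure P] in
lemma IsDrivenWalk.measurable_walkPath (h : IsDrivenWalk φ γ ζ P X Z) (T : ℕ) :
    Measurable (walkPath X Z T) := by
  unfold walkPath
  exact (measurable_pi_lambda _ fun t : Fin (T + 1) => h.measurable_X t).prodMk
    (measurable_pi_lambda _ fun t : Fin T => h.measurable_Z (t + 1))

omit [IsProbabilityMeasure ζ] [IsProbabilityMeasure P] in
lemma IsDrivenWalk.real_step (h : IsDrivenWalk φ γ ζ P X Z) (hφ : φ ∈ Set.Ioo (0 : ℝ) 1)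
    (hγ : γ ∈ Set.Ioo (0 : ℝ) 1) (hsum : 1 ≤ φ + γ) (T : ℕ)
    (s : (Fin (T + 1) → Cube N) × (Fin T → Cube N)) (z y : Cube N) :
    P.real {ω | walkPath X Z T ω = s ∧ Z (T + 1) ω = z ∧ X (T + 1) ω = y} =
      P.real {ω | walkPath X Z T ω = s} *
        (ζ.real {z} * transProb φ γ z (s.1 (Fin.last T)) y) := by
  -- Outside the recorded path the defaults y and z take over, so index T + 1 reads the new step.
  -- The shift t - 1 is there because `s.2` stores the driving vectors from time 1; the value of
  -- `zs` at 0 is never used.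
  set xs : ℕ → Cube N := fun t => if h : t < T + 1 then s.1 ⟨t, h⟩ else y with hxs
  set zs : ℕ → Cube N := fun t => if h : t - 1 < T then s.2 ⟨t - 1, h⟩ else z with hzs
  have hpath : ∀ ω, walkPath X Z T ω = s ↔
      (X 0 ω = xs 0 ∧ ∀ t < T, Z (t + 1) ω = zs (t + 1) ∧ X (t + 1) ω = xs (t + 1)) := by
    intro ω
    rw [Prod.ext_iff, funext_iff, funext_iff]
    change ((∀ t : Fin (T + 1), X t ω = s.1 t) ∧ ∀ t : Fin T, Z (t + 1) ω = s.2 t) ↔ _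
    constructor
    · rintro ⟨h1, h2⟩
      refine ⟨by simpa [hxs] using h1 0, fun t ht => ⟨?_, ?_⟩⟩
      · simpa [hzs, ht] using h2 ⟨t, ht⟩
      · simpa [hxs, ht] using h1 ⟨t + 1, by omega⟩
    · rintro ⟨h0, h1⟩
      refine ⟨fun t => ?_, fun t => ?_⟩
      · obtain ⟨t, ht⟩ := t
        cases t with
        | zero => simpa [hxs] using h0
        | succ t =>
          have := (h1 t (by omega)).2
          simpa [hxs, show t < T by omega] using this
      · obtain ⟨t, ht⟩ := t
        simpa [hzs, ht] using (h1 t ht).1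
  have hxT : xs T = s.1 (Fin.last T) := by simp [hxs, Fin.last]
  have hxT1 : xs (T + 1) = y := by simp [hxs]
  have hzT1 : zs (T + 1) = z := by simp [hzs]
  have e1 : {ω | walkPath X Z T ω = s ∧ Z (T + 1) ω = z ∧ X (T + 1) ω = y} =
      {ω | X 0 ω = xs 0 ∧ ∀ t < T + 1, Z (t + 1) ω = zs (t + 1) ∧ X (t + 1) ω = xs (t + 1)} := by
    ext ω
    simp only [Set.mem_ofPred_eq, hpath, Nat.forall_lt_succ_right, hxT1, hzT1, and_assoc]
  have e2 : {ω | walkPath X Z T ω = s} =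
      {ω | X 0 ω = xs 0 ∧ ∀ t < T, Z (t + 1) ω = zs (t + 1) ∧ X (t + 1) ω = xs (t + 1)} := by
    ext ω
    simp only [Set.mem_ofPred_eq, hpath]
  rw [measureReal_def, e1, h.path_prob, Finset.prod_range_succ, ← mul_assoc, ← h.path_prob, ← e2,
    hxT, hxT1, hzT1, ENNReal.toReal_mul, ENNReal.toReal_mul,
    ENNReal.toReal_ofReal (transProb_nonneg hφ hγ hsum _ _ _)]
  rfl

lemma IsDrivenWalk.indepFun (h : IsDrivenWalk φ γ ζ P X Z) (hφ : φ ∈ Set.Ioo (0 : ℝ) 1)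
    (hγ : γ ∈ Set.Ioo (0 : ℝ) 1) (hsum : 1 ≤ φ + γ) (T : ℕ) :
    IndepFun (walkPath X Z T) (Z (T + 1)) P :=
  indepFun_of_step (h.measurable_walkPath T) (h.measurable_Z _) (h.measurable_X _)
    (h.real_step hφ hγ hsum T) fun _ z => sum_transProb hφ z _

lemma hammingNorm01_comp_perm (z : Cube N) (σ : Equiv.Perm (Fin N)) :
    hammingNorm01 (z ∘ σ) = hammingNorm01 z := by
  have : (hammingNorm01 (z ∘ σ) : ℝ) = hammingNorm01 z := by
    rw [hammingNorm01_eq_sum, hammingNorm01_eq_sum]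
    exact Equiv.sum_comp σ fun k => bit (z k)
  exact_mod_cast this

omit [IsProbabilityMeasure ζ] in
lemma IsExchangeable.real_singleton_comp (hζ : IsExchangeable ζ) (z : Cube N)
    (σ : Equiv.Perm (Fin N)) : ζ.real {z ∘ σ} = ζ.real {z} := by
  conv_lhs => rw [← hζ σ]
  rw [map_measureReal_apply Measurable.of_discrete (measurableSet_singleton _)]
  congr 1
  ext z'
  simp only [Set.mem_preimage, Set.mem_singleton_iff]
  exact ⟨fun h => σ.surjective.injective_comp_right h, fun h => h ▸ rfl⟩

-- The place where exchangeability is used: ζ and the norm are both invariant under permutations, so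
-- each rearrangement of k has the same weighted sum.
omit [IsProbabilityMeasure ζ] in
lemma IsExchangeable.sum_eq_sum_avgKernel (hζ : IsExchangeable ζ) (f : ℕ → ℂ) (k : Cube N → ℂ) :
    ∑ z, (ζ.real {z} : ℂ) * (f (hammingNorm01 z) * k z) =
      ∑ z, (ζ.real {z} : ℂ) * (f (hammingNorm01 z) *
        ((Fintype.card (Equiv.Perm (Fin N)) : ℂ)⁻¹ * ∑ σ : Equiv.Perm (Fin N), k (z ∘ σ))) := by
  have h1 : ∀ σ : Equiv.Perm (Fin N),
      ∑ z, (ζ.real {z} : ℂ) * (f (hammingNorm01 z) * k (z ∘ σ)) =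
        ∑ z, (ζ.real {z} : ℂ) * (f (hammingNorm01 z) * k z) := fun σ => by
    refine Fintype.sum_equiv (Equiv.arrowCongr σ.symm (Equiv.refl Bool)) _ _ fun z => ?_
    have : (Equiv.arrowCongr σ.symm (Equiv.refl Bool)) z = z ∘ σ := by
      ext k; simp [Equiv.arrowCongr]
    rw [this, hζ.real_singleton_comp, hammingNorm01_comp_perm]
  have h2 : ∑ z, (ζ.real {z} : ℂ) * (f (hammingNorm01 z) *
        ((Fintype.card (Equiv.Perm (Fin N)) : ℂ)⁻¹ * ∑ σ : Equiv.Perm (Fin N), k (z ∘ σ))) =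
      (Fintype.card (Equiv.Perm (Fin N)) : ℂ)⁻¹ * ∑ σ : Equiv.Perm (Fin N),
        ∑ z, (ζ.real {z} : ℂ) * (f (hammingNorm01 z) * k (z ∘ σ)) := by
    rw [Finset.sum_comm, Finset.mul_sum]
    refine Finset.sum_congr rfl fun z _ => ?_
    rw [Finset.mul_sum, Finset.mul_sum, Finset.mul_sum, Finset.mul_sum]
    exact Finset.sum_congr rfl fun σ _ => by ring
  rw [h2, Finset.sum_congr rfl fun σ _ => h1 σ, Finset.sum_const, nsmul_eq_mul, ← mul_assoc,
    Finset.card_univ, inv_mul_cancel₀ (by exact_mod_cast Fintype.card_ne_zero), one_mul]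

omit [IsProbabilityMeasure ζ] in
/-- The conditional characteristic function of the scaled norm at time `T + 1`. -/
lemma IsDrivenWalk.integral_mul_exp (h : IsDrivenWalk φ γ ζ P X Z) (hζ : IsExchangeable ζ)
    (hφ : φ ∈ Set.Ioo (0 : ℝ) 1) (hγ : γ ∈ Set.Ioo (0 : ℝ) 1) (hsum : 1 ≤ φ + γ) (T : ℕ) (s : ℝ)
    (F : (Fin (T + 1) → Cube N) × (Fin T → Cube N) → ℕ → ℂ) :
    ∫ ω, F (walkPath X Z T ω) (hammingNorm01 (Z (T + 1) ω)) *
        Complex.exp (s * scaledNorm φ (X (T + 1) ω) * Complex.I) ∂P =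
      ∫ ω, F (walkPath X Z T ω) (hammingNorm01 (Z (T + 1) ω)) *
        avgKernel φ γ s (X T ω) (Z (T + 1) ω) ∂P := by
  have h1 := integral_comp_of_step (h.measurable_walkPath T) (h.measurable_Z (T + 1))
    (h.measurable_X (T + 1)) (p := fun s z y => transProb φ γ z (s.1 (Fin.last T)) y)
    (h.real_step hφ hγ hsum T) (fun u z y => F u (hammingNorm01 z) *
      Complex.exp (s * scaledNorm φ y * Complex.I))
  have h2 := integral_comp_of_step_of_sum_eq_one (h.measurable_walkPath T)
    (h.measurable_Z (T + 1))
    (h.measurable_X (T + 1)) (p := fun s z y => transProb φ γ z (s.1 (Fin.last T)) y)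
    (h.real_step hφ hγ hsum T) (fun _ z => sum_transProb hφ z _)
    (fun u z => F u (hammingNorm01 z) * avgKernel φ γ s (u.1 (Fin.last T)) z)
  have e : ∀ ω, (walkPath X Z T ω).1 (Fin.last T) = X T ω := fun ω => by simp [walkPath]
  simp only [e] at h1 h2
  rw [h1, h2]
  refine integral_congr_ae (ae_of_all _ fun ω => ?_)
  dsimp only
  unfold avgKernel
  rw [← hζ.sum_eq_sum_avgKernel (F (walkPath X Z T ω)) fun z => ∑ y,
    (transProb φ γ z (X T ω) y : ℂ) * Complex.exp (s * scaledNorm φ y * Complex.I)]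
  refine Finset.sum_congr rfl fun z _ => ?_
  congr 1
  rw [Finset.mul_sum]
  exact Finset.sum_congr rfl fun y _ => by ring

end Walk

/-! ### Tools for convergence in distribution -/

section WeakConvergence

variable {Ω : ℕ → Type*} [∀ n, MeasurableSpace (Ω n)] {μ : (n : ℕ) → Measure (Ω n)}
  [∀ n, IsProbabilityMeasure (μ n)] {Ω' : Type*} [MeasurableSpace Ω'] {μ' : Measure Ω'}
  [IsProbabilityMeasure μ']

lemma MeasureTheory.TendstoInDistribution.integral_boundedContinuousFunction {E : Type*} [TopologicalSpace E]
    [MeasurableSpace E] [OpensMeasurableSpace E] {X : (n : ℕ) → Ω n → E} {Z : Ω' → E}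
    (h : TendstoInDistribution X atTop Z μ μ') (f : BoundedContinuousFunction E ℂ) :
    Tendsto (fun n => ∫ ω, f (X n ω) ∂μ n) atTop (𝓝 (∫ ω, f (Z ω) ∂μ')) := by
  have h1 := (ProbabilityMeasure.tendsto_iff_forall_integral_rclike_tendsto ℂ).1 h.tendsto f
  have hf : ∀ ρ : Measure E, AEStronglyMeasurable f ρ := fun ρ =>
    f.continuous.measurable.aestronglyMeasurable
  simp only [ProbabilityMeasure.coe_mk] at h1
  rw [integral_map h.aemeasurable_limit (hf _)] at h1
  refine h1.congr fun n => ?_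
  rw [integral_map (h.forall_aemeasurable n) (hf _)]

/-- **Lévy's continuity theorem** for random variables in a finite-dimensional normed space. -/
lemma tendstoInDistribution_of_forall_dual {E : Type*} [NormedAddCommGroup E] [NormedSpace ℝ E]
    [FiniteDimensional ℝ E] [MeasurableSpace E] [BorelSpace E] {X : (n : ℕ) → Ω n → E} {Z : Ω' → E}
    (hX : ∀ n, Measurable (X n)) (hZ : Measurable Z)
    (h : ∀ L : StrongDual ℝ E,
      Tendsto (fun n => ∫ ω, Complex.exp (L (X n ω) * Complex.I) ∂μ n) atTop
        (𝓝 (∫ ω, Complex.exp (L (Z ω) * Complex.I) ∂μ'))) :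
    TendstoInDistribution X atTop Z μ μ' := by
  let e : E ≃L[ℝ] EuclideanSpace ℝ (Fin (Module.finrank ℝ E)) := toEuclidean
  have he : TendstoInDistribution (fun n => e ∘ X n) atTop (e ∘ Z) μ μ' := by
    refine ⟨fun n => (e.continuous.measurable.comp (hX n)).aemeasurable,
      (e.continuous.measurable.comp hZ).aemeasurable, ?_⟩
    refine ProbabilityMeasure.tendsto_of_tendsto_charFun fun t => ?_
    have hm : ∀ ρ : Measure (EuclideanSpace ℝ (Fin (Module.finrank ℝ E))), AEStronglyMeasurable
        (fun x => Complex.exp ((inner ℝ x t : ℝ) * Complex.I)) ρ := fun ρ =>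
      (by fun_prop : Continuous fun x : EuclideanSpace ℝ (Fin (Module.finrank ℝ E)) =>
        Complex.exp ((inner ℝ x t : ℝ) * Complex.I)).measurable.aestronglyMeasurable
    have h1 := h ((innerSL ℝ t).comp (e : E →L[ℝ] _))
    simp only [charFun_apply, ProbabilityMeasure.coe_mk]
    rw [integral_map (e.continuous.measurable.comp hZ).aemeasurable (hm _)]
    simp_rw [fun n => integral_map (e.continuous.measurable.comp (hX n)).aemeasurable
      (hm ((μ n).map (e ∘ X n)))]
    simpa [real_inner_comm] using h1
  have := he.continuous_comp e.symm.continuous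
  simpa [Function.comp_def] using this

lemma MeasureTheory.TendstoInDistribution.prodMk_of_indepFun {E F : Type*} [TopologicalSpace E]
    [MeasurableSpace E] [OpensMeasurableSpace E] [SecondCountableTopology E]
    [TopologicalSpace.PseudoMetrizableSpace E] [TopologicalSpace F] [MeasurableSpace F]
    [OpensMeasurableSpace F] [SecondCountableTopology F] [TopologicalSpace.PseudoMetrizableSpace F]
    {X : (n : ℕ) → Ω n → E} {Z : Ω' → E} {Y : (n : ℕ) → Ω n → F} {W : Ω' → F}
    (hX : TendstoInDistribution X atTop Z μ μ') (hY : TendstoInDistribution Y atTop W μ μ')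
    (hXY : ∀ n, IndepFun (X n) (Y n) (μ n)) (hZW : IndepFun Z W μ') :
    TendstoInDistribution (fun n ω => (X n ω, Y n ω)) atTop (fun ω => (Z ω, W ω)) μ μ' := by
  refine ⟨fun n => (hX.forall_aemeasurable n).prodMk (hY.forall_aemeasurable n),
    hX.aemeasurable_limit.prodMk hY.aemeasurable_limit, ?_⟩
  have h := (ProbabilityMeasure.continuous_prod.tendsto _).comp
    (hX.tendsto.prodMk_nhds hY.tendsto)
  have e1 : (⟨μ'.map fun ω => (Z ω, W ω), Measure.isProbabilityMeasure_map
      (hX.aemeasurable_limit.prodMk hY.aemeasurable_limit)⟩ : ProbabilityMeasure (E × F)) =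
      ProbabilityMeasure.prod
        ⟨μ'.map Z, Measure.isProbabilityMeasure_map hX.aemeasurable_limit⟩
        ⟨μ'.map W, Measure.isProbabilityMeasure_map hY.aemeasurable_limit⟩ :=
    Subtype.ext ((indepFun_iff_map_prod_eq_prod_map_map hX.aemeasurable_limit
      hY.aemeasurable_limit).1 hZW)
  rw [e1]
  refine h.congr fun n => ?_
  exact Subtype.ext ((indepFun_iff_map_prod_eq_prod_map_map (hX.forall_aemeasurable n)
      (hY.forall_aemeasurable n)).1 (hXY n)).symm

/-- Convergence of characteristic functions to a continuous limit makes the whole sequence of laws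
tight, so one M serves every n. -/
lemma MeasureTheory.TendstoInDistribution.exists_forall_measureReal_abs_gt_le {X : (n : ℕ) → Ω n → ℝ}
    {Z : Ω' → ℝ} (h : TendstoInDistribution X atTop Z μ μ') {δ : ℝ} (hδ : 0 < δ) :
    ∃ M : ℝ, ∀ n, (μ n).real {ω | M < |X n ω|} ≤ δ := by
  have := fun n => Measure.isProbabilityMeasure_map (μ := μ n) (h.forall_aemeasurable n)
  have := Measure.isProbabilityMeasure_map (μ := μ') h.aemeasurable_limit
  have ht : IsTightMeasureSet (Set.range fun n => (μ n).map (X n)) :=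
    isTightMeasureSet_of_tendsto_charFun (f := charFun (μ'.map Z)) (by fun_prop)
      (ProbabilityMeasure.tendsto_iff_tendsto_charFun.1 h.tendsto)
  have ht' := tendsto_measure_norm_gt_of_isTightMeasureSet ht
  obtain ⟨M, hM⟩ := (ht'.eventually_lt_const (u := ENNReal.ofReal δ) (by simpa using hδ)).exists
  refine ⟨M, fun n => ?_⟩
  have h1 : (μ n).map (X n) {x | M < ‖x‖} ≤ ENNReal.ofReal δ :=
    (le_iSup₂ (f := fun (ν : Measure ℝ) (_ : ν ∈ Set.range fun n => (μ n).map (X n)) =>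
      ν {x | M < ‖x‖}) _ ⟨n, rfl⟩).trans hM.le
  rw [Measure.map_apply_of_aemeasurable (h.forall_aemeasurable n)
    (measurableSet_lt measurable_const measurable_norm)] at h1
  rw [measureReal_def]
  exact ENNReal.toReal_le_of_le_ofReal hδ.le h1

/-- Convergence of a pair from convergence of the first component and of the conditional
characteristic functions of the second. -/
lemma MeasureTheory.TendstoInDistribution.prodMk_of_forall_integral {E : Type*} [NormedAddCommGroup E]
    [NormedSpace ℝ E] [FiniteDimensional ℝ E] [MeasurableSpace E] [BorelSpace E]
    {U : (n : ℕ) → Ω n → E} {U' : Ω' → E} {V : (n : ℕ) → Ω n → ℝ} {V' : Ω' → ℝ}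
    (hU : ∀ n, Measurable (U n)) (hU' : Measurable U') (hV : ∀ n, Measurable (V n))
    (hV' : Measurable V')
    (h : ∀ (f : BoundedContinuousFunction E ℂ) (s : ℝ),
      Tendsto (fun n => ∫ ω, f (U n ω) * Complex.exp (s * V n ω * Complex.I) ∂μ n) atTop
        (𝓝 (∫ ω, f (U' ω) * Complex.exp (s * V' ω * Complex.I) ∂μ'))) :
    TendstoInDistribution (fun n ω => (U n ω, V n ω)) atTop (fun ω => (U' ω, V' ω)) μ μ' := by
  refine tendstoInDistribution_of_forall_dual (fun n => (hU n).prodMk (hV n)) (hU'.prodMk hV')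
    fun L => ?_
  -- A linear functional on the product splits as its restriction to E plus L(0,1) times the real
  -- coordinate, so its character is an admissible f times the exponential.
  have h1 := h (BoundedContinuousFunction.probCharDual
    (L.comp (ContinuousLinearMap.inl ℝ E ℝ))) (L (0, 1))
  have h2 : ∀ (u : E) (v : ℝ), BoundedContinuousFunction.probCharDual
      (L.comp (ContinuousLinearMap.inl ℝ E ℝ)) u * Complex.exp ((L (0, 1) : ℝ) * v * Complex.I) =
      Complex.exp ((L (u, v) : ℝ) * Complex.I) := by
    intro u v
    have : (u, v) = (u, 0) + v • ((0, 1) : E × ℝ) := by simp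
    rw [BoundedContinuousFunction.probCharDual_apply, ← Complex.exp_add, this, map_add, map_smul]
    congr 1
    simp
    ring
  simpa only [h2] using h1

/-- Passing to the limit in `∫ f(Uₙ) Kₙ` when `Kₙ` is asymptotically a continuous function of `Uₙ`. -/
lemma MeasureTheory.TendstoInDistribution.tendsto_integral_mul {E : Type*} [TopologicalSpace E]
    [MeasurableSpace E] [BorelSpace E] {U : (n : ℕ) → Ω n → E} {U' : Ω' → E}
    (h : TendstoInDistribution U atTop U' μ μ') (hU : ∀ n, Measurable (U n))
    (f : BoundedContinuousFunction E ℂ) {K : (n : ℕ) → Ω n → ℂ} (hK : ∀ n, Measurable (K n))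
    (hK1 : ∀ n ω, ‖K n ω‖ ≤ 1) {k : E → ℂ} (hk : Continuous k) (hk1 : ∀ u, ‖k u‖ ≤ 1)
    (hdiff : Tendsto (fun n => ∫ ω, f (U n ω) * (K n ω - k (U n ω)) ∂μ n) atTop (𝓝 0)) :
    Tendsto (fun n => ∫ ω, f (U n ω) * K n ω ∂μ n) atTop (𝓝 (∫ ω, f (U' ω) * k (U' ω) ∂μ')) := by
  have hg := h.integral_boundedContinuousFunction
    (f * BoundedContinuousFunction.ofNormedAddCommGroup k hk 1 hk1)
  have hadd := hdiff.add hg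
  rw [zero_add] at hadd
  refine hadd.congr fun n => ?_
  have hfm : Measurable fun ω => f (U n ω) := f.continuous.measurable.comp (hU n)
  have hkm : Measurable fun ω => k (U n ω) := hk.measurable.comp (hU n)
  have hfi : ∀ {g : Ω n → ℂ}, Measurable g → (∀ ω, ‖g ω‖ ≤ 2) →
      Integrable (fun ω => f (U n ω) * g ω) (μ n) := fun hg hg2 =>
    Integrable.of_bound (C := ‖f‖ * 2) (hfm.mul hg).aestronglyMeasurable (ae_of_all _ fun ω => by
      rw [norm_mul]
      exact mul_le_mul (f.norm_coe_le_norm _) (hg2 ω) (norm_nonneg _) (norm_nonneg _))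
  have h1 : ∫ ω, (f * BoundedContinuousFunction.ofNormedAddCommGroup k hk 1 hk1) (U n ω) ∂μ n =
      ∫ ω, f (U n ω) * k (U n ω) ∂μ n := rfl
  rw [h1, ← integral_add]
  · exact integral_congr_ae (ae_of_all _ fun ω => by dsimp only; ring)
  · exact hfi ((hK n).sub hkm) fun ω => (norm_sub_le _ _).trans (by linarith [hK1 n ω, hk1 (U n ω)])
  · exact hfi hkm fun ω => (hk1 _).trans (by norm_num)

end WeakConvergence

/-! ### Gaussian variables with random mean and variance -/

section GaussianStep

variable {Ω E : Type*} [MeasurableSpace Ω] [MeasurableSpace E] {P : Measure Ω}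
  [IsProbabilityMeasure P]

/-- The kernel `u ↦ N(m u, σ u ^ 2)`. -/
noncomputable def gaussianKernel {m σ : E → ℝ} (hm : Measurable m) (hσ : Measurable σ) :
    Kernel E ℝ where
  toFun u := gaussianReal (m u) (σ u ^ 2).toNNReal
  measurable' := by
    -- Measurability in u follows by writing the law as the image of a fixed standard normal under m
    -- u + σ u x.
    have h : ∀ u, gaussianReal (m u) (σ u ^ 2).toNNReal =
        ((Kernel.id ×ₖ Kernel.const E (gaussianReal 0 1)).map
          fun p : E × ℝ => m p.1 + σ p.1 * p.2) u := by
      intro u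
      rw [Kernel.map_apply _ (by fun_prop), Kernel.prod_apply, Kernel.id_apply, Kernel.const_apply,
        Measure.dirac_prod, Measure.map_map (by fun_prop) (by fun_prop)]
      have e : ((fun p : E × ℝ => m p.1 + σ p.1 * p.2) ∘ Prod.mk u) =
          (fun x => m u + x) ∘ fun x => σ u * x := rfl
      rw [e, ← Measure.map_map (by fun_prop) (by fun_prop), gaussianReal_map_const_mul,
        gaussianReal_map_const_add]
      congr 1
      · ring
      · rw [mul_one]; exact Real.toNNReal_of_nonneg (sq_nonneg _)
    simp_rw [h]
    exact Kernel.measurable _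

instance {m σ : E → ℝ} (hm : Measurable m) (hσ : Measurable σ) :
    IsMarkovKernel (gaussianKernel hm hσ) :=
  ⟨fun u => by change IsProbabilityMeasure (gaussianReal _ _); infer_instance⟩

lemma gaussianKernel_apply_eq_map {m σ : E → ℝ} (hm : Measurable m) (hσ : Measurable σ) (u : E) :
    gaussianKernel hm hσ u = (gaussianReal 0 1).map fun x => m u + σ u * x := by
  have e : (fun x => m u + σ u * x) = (fun x => m u + x) ∘ fun x => σ u * x := rfl
  rw [e, ← Measure.map_map (by fun_prop) (by fun_prop), gaussianReal_map_const_mul,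
    gaussianReal_map_const_add]
  change gaussianReal _ _ = _
  congr 1
  · ring
  · rw [mul_one]; exact Real.toNNReal_of_nonneg (sq_nonneg _)

lemma map_prodMk_add_mul_eq_compProd {U : Ω → E} {ξ : Ω → ℝ} (hU : Measurable U)
    (hξ : Measurable ξ) (hlaw : P.map ξ = gaussianReal 0 1) (hind : IndepFun U ξ P) {m σ : E → ℝ}
    (hm : Measurable m) (hσ : Measurable σ) :
    P.map (fun ω => (U ω, m (U ω) + σ (U ω) * ξ ω)) = P.map U ⊗ₘ gaussianKernel hm hσ := by
  have := Measure.isProbabilityMeasure_map (μ := P) hU.aemeasurable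
  have h1 := (indepFun_iff_map_prod_eq_prod_map_map hU.aemeasurable hξ.aemeasurable).1 hind
  have h2 : P.map (fun ω => (U ω, m (U ω) + σ (U ω) * ξ ω)) =
      ((P.map U).prod (gaussianReal 0 1)).map fun p => (p.1, m p.1 + σ p.1 * p.2) := by
    rw [← hlaw, ← h1, Measure.map_map (by fun_prop) (by fun_prop)]
    rfl
  rw [h2]
  ext A hA
  rw [Measure.map_apply (by fun_prop) hA, Measure.prod_apply (by measurability),
    Measure.compProd_apply hA]
  refine lintegral_congr fun u => ?_
  rw [gaussianKernel_apply_eq_map, Measure.map_apply (by fun_prop) (by measurability)]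
  rfl

/-- Conditional characteristic function of a Gaussian variable with random parameters. -/
lemma integral_mul_exp_add_mul {U : Ω → E} {ξ : Ω → ℝ} (hU : Measurable U)
    (hξ : Measurable ξ) (hlaw : P.map ξ = gaussianReal 0 1) (hind : IndepFun U ξ P) {m σ : E → ℝ}
    (hm : Measurable m) (hσ : Measurable σ) {f : E → ℂ} (hf : Measurable f) {C : ℝ}
    (hC : ∀ u, ‖f u‖ ≤ C) (s : ℝ) :
    ∫ ω, f (U ω) * Complex.exp (s * (m (U ω) + σ (U ω) * ξ ω : ℝ) * Complex.I) ∂P =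
      ∫ ω, f (U ω) * charFun (gaussianReal (m (U ω)) (σ (U ω) ^ 2).toNNReal) s ∂P := by
  have := Measure.isProbabilityMeasure_map (μ := P) hU.aemeasurable
  have hF : Measurable fun p : E × ℝ => f p.1 * Complex.exp (s * p.2 * Complex.I) := by fun_prop
  have hG : Measurable fun u => f u * charFun (gaussianReal (m u) (σ u ^ 2).toNNReal) s := by
    simp_rw [charFun_gaussianReal]
    fun_prop
  have hint : Integrable (fun p : E × ℝ => f p.1 * Complex.exp (s * p.2 * Complex.I))
      (P.map U ⊗ₘ gaussianKernel hm hσ) := by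
    refine Integrable.of_bound hF.aestronglyMeasurable C (ae_of_all _ fun p => ?_)
    rw [norm_mul, ← Complex.ofReal_mul, Complex.norm_exp_ofReal_mul_I, mul_one]
    exact hC _
  have hmeas : Measurable fun ω => (U ω, m (U ω) + σ (U ω) * ξ ω) := by fun_prop
  calc _ = ∫ p, f p.1 * Complex.exp (s * p.2 * Complex.I)
        ∂(P.map fun ω => (U ω, m (U ω) + σ (U ω) * ξ ω)) := by
        rw [integral_map hmeas.aemeasurable hF.aestronglyMeasurable]
    _ = ∫ u, f u * charFun (gaussianReal (m u) (σ u ^ 2).toNNReal) s ∂P.map U := by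
        rw [map_prodMk_add_mul_eq_compProd hU hξ hlaw hind hm hσ, Measure.integral_compProd hint]
        refine integral_congr_ae (ae_of_all _ fun u => ?_)
        dsimp only
        rw [integral_const_mul, charFun_apply_real]
        rfl
    _ = _ := integral_map hU.aemeasurable hG.aestronglyMeasurable

lemma indepFun_prodMk_of_indepFun_prodMk {A B C : Type*} [MeasurableSpace A] [MeasurableSpace B]
    [MeasurableSpace C] {f : Ω → A} {g : Ω → B} {h : Ω → C} (hf : Measurable f) (hg : Measurable g)
    (hh : Measurable h) (h1 : IndepFun f (fun ω => (g ω, h ω)) P) (h2 : IndepFun g h P) :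
    IndepFun (fun ω => (f ω, g ω)) h P := by
  have := Measure.isProbabilityMeasure_map (μ := P) hf.aemeasurable
  have := Measure.isProbabilityMeasure_map (μ := P) hg.aemeasurable
  have := Measure.isProbabilityMeasure_map (μ := P) hh.aemeasurable
  have h3 : IndepFun f g P := h1.comp measurable_id measurable_fst
  rw [indepFun_iff_map_prod_eq_prod_map_map (by fun_prop) (by fun_prop)] at h1 h2 h3 ⊢
  rw [h3, ← (MeasurableEquiv.prodAssoc).map_measurableEquiv_injective.eq_iff]
  rw [Measure.prodAssoc_prod, ← h2, ← h1, Measure.map_map (by fun_prop) (by fun_prop)]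
  rfl

end GaussianStep

/-! ### Construction of the autoregressive limit -/

section LimitProcess

/-- The sample space of the limit process: an initial value and independent pairs `(Θ_t, ξ_t)`. -/
abbrev LimitSpace : Type := ℝ × (ℕ → ℝ × ℝ)

/-- The law on the sample space of the limit process. -/
noncomputable def limitMeasure (ν μ₀ : Measure ℝ) : Measure LimitSpace :=
  μ₀.prod (Measure.infinitePi fun _ : ℕ => ν.prod (gaussianReal 0 1))

instance (ν μ₀ : Measure ℝ) [IsProbabilityMeasure ν] [IsProbabilityMeasure μ₀] :
    IsProbabilityMeasure (limitMeasure ν μ₀) := by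
  unfold limitMeasure; infer_instance

/-- The random coefficients of the limit process. -/
def limitTheta (t : ℕ) (ω : LimitSpace) : ℝ := (ω.2 t).1

/-- The standardized innovations of the limit process. -/
def limitXi (t : ℕ) (ω : LimitSpace) : ℝ := (ω.2 t).2

/-- The innovations of the limit process. -/
noncomputable def limitEps (α : ℝ) (t : ℕ) (ω : LimitSpace) : ℝ :=
  √(innovVar α (limitTheta t ω)) * limitXi t ω

/-- The autoregressive limit process. -/
noncomputable def limitV (α c : ℝ) : ℕ → LimitSpace → ℝ
  | 0, ω => ω.1
  | t + 1, ω => (1 - limitTheta (t + 1) ω / α) * (c + limitV α c t ω) + limitEps α (t + 1) ω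

/-- The path of the limit process and of its coefficients up to time `T`. -/
noncomputable def limitPath (α c : ℝ) (T : ℕ) (ω : LimitSpace) : (Fin (T + 1) → ℝ) × (Fin T → ℝ) :=
  (fun t => limitV α c t ω, fun t => limitTheta (t + 1) ω)

variable {α c : ℝ} {ν μ₀ : Measure ℝ} [IsProbabilityMeasure ν] [IsProbabilityMeasure μ₀]

@[fun_prop]
lemma measurable_innovVar (α : ℝ) : Measurable (innovVar α) := by
  unfold innovVar; fun_prop

@[fun_prop]
lemma measurable_limitTheta (t : ℕ) : Measurable (limitTheta t) := by
  unfold limitTheta; fun_prop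

@[fun_prop]
lemma measurable_limitXi (t : ℕ) : Measurable (limitXi t) := by
  unfold limitXi; fun_prop

@[fun_prop]
lemma measurable_limitEps (α : ℝ) (t : ℕ) : Measurable (limitEps α t) := by
  unfold limitEps; fun_prop

@[fun_prop]
lemma measurable_limitV (α c : ℝ) (t : ℕ) : Measurable (limitV α c t) := by
  induction t with
  | zero => exact measurable_fst
  | succ t ih =>
    change Measurable fun ω =>
      (1 - limitTheta (t + 1) ω / α) * (c + limitV α c t ω) + limitEps α (t + 1) ω
    fun_prop

@[fun_prop]
lemma measurable_limitPath (α c : ℝ) (T : ℕ) : Measurable (limitPath α c T) := by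
  unfold limitPath
  exact (measurable_pi_lambda _ fun t : Fin (T + 1) => measurable_limitV α c t).prodMk
    (measurable_pi_lambda _ fun t : Fin T => measurable_limitTheta (t + 1))

omit [IsProbabilityMeasure μ₀] in
lemma limitMeasure_map_fst : (limitMeasure ν μ₀).map Prod.fst = μ₀ := by
  simp [limitMeasure, Measure.map_fst_prod]

lemma limitMeasure_map_snd : (limitMeasure ν μ₀).map Prod.snd =
    Measure.infinitePi fun _ : ℕ => ν.prod (gaussianReal 0 1) := by
  simp [limitMeasure, Measure.map_snd_prod]

lemma limitMeasure_map_pair (t : ℕ) :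
    (limitMeasure ν μ₀).map (fun ω => (limitTheta t ω, limitXi t ω)) =
      ν.prod (gaussianReal 0 1) := by
  have e : (fun ω => (limitTheta t ω, limitXi t ω)) = Function.eval t ∘ Prod.snd := rfl
  rw [e, ← Measure.map_map (by fun_prop) (by fun_prop), limitMeasure_map_snd,
    Measure.infinitePi_map_eval]

lemma limitMeasure_map_limitTheta (t : ℕ) : (limitMeasure ν μ₀).map (limitTheta t) = ν := by
  have e : limitTheta t = Prod.fst ∘ fun ω => (limitTheta t ω, limitXi t ω) := rfl
  rw [e, ← Measure.map_map (by fun_prop) (by fun_prop), limitMeasure_map_pair]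
  simp [Measure.map_fst_prod]

lemma limitMeasure_map_limitXi (t : ℕ) :
    (limitMeasure ν μ₀).map (limitXi t) = gaussianReal 0 1 := by
  have e : limitXi t = Prod.snd ∘ fun ω => (limitTheta t ω, limitXi t ω) := rfl
  rw [e, ← Measure.map_map (by fun_prop) (by fun_prop), limitMeasure_map_pair]
  simp [Measure.map_snd_prod]

lemma indepFun_limitTheta_limitXi (t : ℕ) :
    IndepFun (limitTheta t) (limitXi t) (limitMeasure ν μ₀) := by
  rw [indepFun_iff_map_prod_eq_prod_map_map (by fun_prop) (by fun_prop), limitMeasure_map_pair,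
    limitMeasure_map_limitTheta, limitMeasure_map_limitXi]

lemma iIndepFun_limitPairs :
    iIndepFun (fun (t : ℕ) (ω : LimitSpace) => ω.2 t) (limitMeasure ν μ₀) := by
  rw [iIndepFun_iff_map_fun_eq_infinitePi_map (by fun_prop)]
  have e : ∀ t : ℕ, (limitMeasure ν μ₀).map (fun ω : LimitSpace => ω.2 t) =
      ν.prod (gaussianReal 0 1) := limitMeasure_map_pair
  simp_rw [e]
  exact limitMeasure_map_snd

lemma indepFun_fst_snd_limitMeasure :
    IndepFun (Prod.fst : LimitSpace → ℝ) Prod.snd (limitMeasure ν μ₀) := by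
  rw [indepFun_iff_map_prod_eq_prod_map_map (by fun_prop) (by fun_prop), limitMeasure_map_fst,
    limitMeasure_map_snd]
  exact Measure.map_id

/-- The initial value and the pairs up to time `t`, extended by zero. -/
noncomputable def truncate (t : ℕ) (q : ℝ × (Finset.range (t + 1) → ℝ × ℝ)) : LimitSpace :=
  (q.1, fun i => if h : i ∈ Finset.range (t + 1) then q.2 ⟨i, h⟩ else 0)

lemma measurable_truncate (t : ℕ) : Measurable (truncate t) := by
  refine measurable_fst.prodMk (measurable_pi_lambda _ fun i => ?_)
  by_cases h : i ∈ Finset.range (t + 1)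
  · simp only [h, dite_true]; fun_prop
  · simp only [h, dite_false]; fun_prop

/-- The path up to T is a function of the initial value and finitely many pairs, which is what makes
it independent of the pair at time T + 1. -/
lemma limitPath_truncate (α c : ℝ) (T : ℕ) (ω : LimitSpace) :
    limitPath α c T (truncate T (ω.1, fun i => ω.2 i)) = limitPath α c T ω := by
  have h2 : ∀ i ≤ T, (truncate T (ω.1, fun i => ω.2 i)).2 i = ω.2 i := fun i hi =>
    dif_pos (Finset.mem_range.2 (by omega))
  have hΘ : ∀ i ≤ T, limitTheta i (truncate T (ω.1, fun i => ω.2 i)) = limitTheta i ω :=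
    fun i hi => by rw [limitTheta, h2 i hi, limitTheta]
  have hξ : ∀ i ≤ T, limitXi i (truncate T (ω.1, fun i => ω.2 i)) = limitXi i ω :=
    fun i hi => by rw [limitXi, h2 i hi, limitXi]
  have hV : ∀ i ≤ T, limitV α c i (truncate T (ω.1, fun i => ω.2 i)) = limitV α c i ω := by
    intro i
    induction i with
    | zero => intro _; rfl
    | succ i ih =>
      intro hi
      rw [limitV, limitV, ih (by omega), limitEps, limitEps, hΘ _ hi, hξ _ hi]
  refine Prod.ext (funext fun t => hV t (by omega)) (funext fun t => hΘ _ (by omega))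

lemma indepFun_limitPath (T : ℕ) : IndepFun (limitPath α c T)
    (fun ω => (limitTheta (T + 1) ω, limitXi (T + 1) ω)) (limitMeasure ν μ₀) := by
  have h1 : IndepFun (fun (ω : LimitSpace) (i : Finset.range (T + 1)) => ω.2 i)
      (fun (ω : LimitSpace) => ω.2 (T + 1)) (limitMeasure ν μ₀) := by
    have h := iIndepFun_limitPairs (ν := ν) (μ₀ := μ₀).indepFun_finset (Finset.range (T + 1))
      {T + 1} (by simp) (by fun_prop)
    exact h.comp measurable_id (measurable_pi_apply (⟨T + 1, by simp⟩ : ({T + 1} : Finset ℕ)))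
  have h2 : IndepFun (Prod.fst : LimitSpace → ℝ)
      (fun ω => ((fun i : Finset.range (T + 1) => ω.2 i), ω.2 (T + 1))) (limitMeasure ν μ₀) :=
    indepFun_fst_snd_limitMeasure.comp (φ := id)
      (ψ := fun p : ℕ → ℝ × ℝ => ((fun i : Finset.range (T + 1) => p i), p (T + 1)))
      measurable_id (by fun_prop)
  have h3 := indepFun_prodMk_of_indepFun_prodMk (by fun_prop) (by fun_prop) (by fun_prop) h2 h1
  have h4 := h3.comp (φ := fun q => limitPath α c T (truncate T q)) (ψ := id)
    ((measurable_limitPath α c T).comp (measurable_truncate T)) measurable_id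
  have e : (fun q => limitPath α c T (truncate T q)) ∘
      (fun ω : LimitSpace => (ω.1, fun i : Finset.range (T + 1) => ω.2 i)) = limitPath α c T :=
    funext fun ω => limitPath_truncate α c T ω
  rw [e] at h4
  exact h4

lemma indepFun_limitPath_limitTheta (T : ℕ) :
    IndepFun (limitPath α c T) (limitTheta (T + 1)) (limitMeasure ν μ₀) :=
  (indepFun_limitPath T).comp measurable_id measurable_fst

lemma indepFun_limitPath_prodMk_limitXi (T : ℕ) :
    IndepFun (fun ω => (limitPath α c T ω, limitTheta (T + 1) ω)) (limitXi (T + 1))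
      (limitMeasure ν μ₀) :=
  indepFun_prodMk_of_indepFun_prodMk (by fun_prop) (by fun_prop) (by fun_prop)
    (indepFun_limitPath T) (indepFun_limitTheta_limitXi _)

lemma indepFun_limitTheta_limitEps_limitV (t : ℕ) :
    IndepFun (fun ω => (limitTheta (t + 1) ω, limitEps α (t + 1) ω)) (limitV α c t)
      (limitMeasure ν μ₀) := by
  have h := (indepFun_limitPath (α := α) (c := c) (ν := ν) (μ₀ := μ₀) t).comp
    (φ := fun w => w.1 (Fin.last t)) (ψ := fun p : ℝ × ℝ => (p.1, √(innovVar α p.1) * p.2))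
    (by fun_prop) (by fun_prop)
  exact h.symm

/-- Square root and `toNNReal` both truncate at 0, so no sign condition on the variance is needed in
constructing the process. -/
lemma sqrt_sq_toNNReal (x : ℝ) : (√x ^ 2).toNNReal = x.toNNReal := by
  rcases le_total 0 x with h | h
  · rw [Real.sq_sqrt h]
  · rw [Real.sqrt_eq_zero_of_nonpos h, Real.toNNReal_of_nonpos h]; simp

/-- The limit process is a normal AR(1) series with random coefficients. -/
theorem isRandomCoefAR1_limit :
    IsRandomCoefAR1 α c ν μ₀ (limitMeasure ν μ₀) (limitV α c) limitTheta (limitEps α) where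
  measurable_V := measurable_limitV α c
  measurable_Θ := measurable_limitTheta
  measurable_ε := measurable_limitEps α
  law_zero := limitMeasure_map_fst
  law_Θ t := limitMeasure_map_limitTheta _
  cond_ε t := by
    have h := map_prodMk_add_mul_eq_compProd (measurable_limitTheta (t + 1))
      (measurable_limitXi (t + 1)) (limitMeasure_map_limitXi (t + 1))
      (indepFun_limitTheta_limitXi (ν := ν) (μ₀ := μ₀) (t + 1)) (m := fun _ => 0)
      (σ := fun θ => √(innovVar α θ)) measurable_const (by fun_prop)
    simp only [zero_add] at h
    have h2 := condDistrib_ae_eq_of_measure_eq_compProd (limitTheta (t + 1))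
      (measurable_limitEps α (t + 1)).aemeasurable h
    rw [limitMeasure_map_limitTheta] at h2
    filter_upwards [h2] with θ hθ
    rw [hθ, ← sqrt_sq_toNNReal]
    rfl
  indep_pairs := by
    -- The pair with index 0 is never used; the series starts at index 1.
    have h := (iIndepFun_limitPairs (ν := ν) (μ₀ := μ₀)).precomp (g := fun t : ℕ => t + 1)
      (add_left_injective 1)
    exact h.comp (fun _ p => (p.1, √(innovVar α p.1) * p.2)) fun _ => by fun_prop
  indep_zero := indepFun_fst_snd_limitMeasure.comp (φ := id)
    (ψ := fun (p : ℕ → ℝ × ℝ) (t : ℕ) =>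
      ((p (t + 1)).1, √(innovVar α (p (t + 1)).1) * (p (t + 1)).2)) measurable_id (by fun_prop)
  recursion _ _ := rfl

/-- Conditional law of the limit process after one step. -/
theorem condDistrib_limitV (t : ℕ) :
    ∀ᵐ q ∂((limitMeasure ν μ₀).map fun ω => (limitV α c t ω, limitTheta (t + 1) ω)),
      condDistrib (limitV α c (t + 1)) (fun ω => (limitV α c t ω, limitTheta (t + 1) ω))
        (limitMeasure ν μ₀) q =
          gaussianReal ((1 - q.2 / α) * (q.1 + c)) (innovVar α q.2).toNNReal := by
  have hind : IndepFun (fun ω => (limitV α c t ω, limitTheta (t + 1) ω)) (limitXi (t + 1))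
      (limitMeasure ν μ₀) :=
    (indepFun_limitPath_prodMk_limitXi (α := α) (c := c) t).comp
      (φ := fun w => (w.1.1 (Fin.last t), w.2)) (ψ := id) (by fun_prop) measurable_id
  have h := map_prodMk_add_mul_eq_compProd (by fun_prop) (measurable_limitXi (t + 1))
      (limitMeasure_map_limitXi (t + 1)) hind (m := fun q : ℝ × ℝ => (1 - q.2 / α) * (q.1 + c))
      (σ := fun q => √(innovVar α q.2)) (by fun_prop) (by fun_prop)
  have e : (fun ω => ((limitV α c t ω, limitTheta (t + 1) ω),
      (1 - limitTheta (t + 1) ω / α) * (limitV α c t ω + c) +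
        √(innovVar α (limitTheta (t + 1) ω)) * limitXi (t + 1) ω)) =
      fun ω => ((limitV α c t ω, limitTheta (t + 1) ω), limitV α c (t + 1) ω) := by
    funext ω
    rw [limitV, limitEps, add_comm c]
  simp only [e] at h
  have h2 := condDistrib_ae_eq_of_measure_eq_compProd _
      (measurable_limitV α c (t + 1)).aemeasurable h
  filter_upwards [h2] with q hq
  rw [hq, ← sqrt_sq_toNNReal]
  rfl

/-- Conditional characteristic function of the limit process after one step. -/
lemma integral_limitPath_mul_exp (T : ℕ) {f : ((Fin (T + 1) → ℝ) × (Fin T → ℝ)) × ℝ → ℂ}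
    (hf : Measurable f) {C : ℝ} (hC : ∀ u, ‖f u‖ ≤ C) (s : ℝ) :
    ∫ ω, f (limitPath α c T ω, limitTheta (T + 1) ω) *
        Complex.exp (s * limitV α c (T + 1) ω * Complex.I) ∂limitMeasure ν μ₀ =
      ∫ ω, f (limitPath α c T ω, limitTheta (T + 1) ω) *
        limKernel α c s (limitV α c T ω) (limitTheta (T + 1) ω) ∂limitMeasure ν μ₀ := by
  have h := integral_mul_exp_add_mul (by fun_prop) (measurable_limitXi (T + 1))
    (limitMeasure_map_limitXi (T + 1))
    (indepFun_limitPath_prodMk_limitXi (α := α) (c := c) (ν := ν) (μ₀ := μ₀) T)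
    (m := fun u => (1 - u.2 / α) * (u.1.1 (Fin.last T) + c))
    (σ := fun u => √(innovVar α u.2)) (by fun_prop) (by fun_prop) hf hC s
  have e : ∀ ω, (limitPath α c T ω).1 (Fin.last T) = limitV α c T ω := fun ω => rfl
  simp only [e, sqrt_sq_toNNReal, charFun_gaussianReal_eq_limKernel] at h
  rw [← h]
  refine integral_congr_ae (ae_of_all _ fun ω => ?_)
  dsimp only
  rw [limitV, limitEps, add_comm c]

end LimitProcess

/-! ### Convergence of the finite-dimensional distributions -/

section Convergence

lemma measurable_comp_two_of_finite {Ω S R E : Type*} [MeasurableSpace Ω] [Finite S]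
    [MeasurableSpace S] [MeasurableSingletonClass S] [Finite R] [MeasurableSpace R]
    [MeasurableSingletonClass R] [MeasurableSpace E] {x : Ω → S} {z : Ω → R} (hx : Measurable x)
    (hz : Measurable z) (g : S → R → E) : Measurable fun ω => g (x ω) (z ω) :=
  (Measurable.of_discrete (f := fun p : S × R => g p.1 p.2)).comp (hx.prodMk hz)

lemma MeasureTheory.TendstoInDistribution.congr_law {ι E Ω' Ω'' : Type*} {Ω : ι → Type*}
    {m : ∀ i, MeasurableSpace (Ω i)} {μ : (i : ι) → Measure (Ω i)} [∀ i, IsProbabilityMeasure (μ i)]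
    {m' : MeasurableSpace Ω'} {μ' : Measure Ω'} [IsProbabilityMeasure μ']
    {m'' : MeasurableSpace Ω''} {μ'' : Measure Ω''} [IsProbabilityMeasure μ'']
    {mE : MeasurableSpace E} [TopologicalSpace E] [OpensMeasurableSpace E] {X : (i : ι) → Ω i → E}
    {Z : Ω' → E} {W : Ω'' → E} {l : Filter ι} (h : TendstoInDistribution X l Z μ μ')
    (hW : AEMeasurable W μ'') (hlaw : μ''.map W = μ'.map Z) :
    TendstoInDistribution X l W μ μ'' := by
  refine ⟨h.forall_aemeasurable, hW, ?_⟩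
  have e : (⟨μ''.map W, Measure.isProbabilityMeasure_map hW⟩ : ProbabilityMeasure E) =
      ⟨μ'.map Z, Measure.isProbabilityMeasure_map h.aemeasurable_limit⟩ := Subtype.ext hlaw
  rw [e]
  exact h.tendsto

/-- The scaled norms of a path of the walk and the proportions of its driving vectors. -/
noncomputable def scaledPath {N : ℕ} (φ : ℝ) (T : ℕ)
    (u : (Fin (T + 1) → Cube N) × (Fin T → Cube N)) : (Fin (T + 1) → ℝ) × (Fin T → ℝ) :=
  (fun t => scaledNorm φ (u.1 t), fun t => (hammingNorm01 (u.2 t) : ℝ) / N)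

/-- Append the next coefficient and the next value to a path. -/
def appendPath (T : ℕ) (p : (((Fin (T + 1) → ℝ) × (Fin T → ℝ)) × ℝ) × ℝ) :
    (Fin (T + 1 + 1) → ℝ) × (Fin (T + 1) → ℝ) :=
  (fun t => if h : (t : ℕ) < T + 1 then p.1.1.1 ⟨t, h⟩ else p.2,
    fun t => if h : (t : ℕ) < T then p.1.1.2 ⟨t, h⟩ else p.1.2)

lemma continuous_appendPath (T : ℕ) : Continuous (appendPath T) := by
  unfold appendPath
  refine (continuous_pi fun t => ?_).prodMk (continuous_pi fun t => ?_)
  · by_cases h : (t : ℕ) < T + 1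
    · simp only [h, dite_true]; fun_prop
    · simp only [h, dite_false]; fun_prop
  · by_cases h : (t : ℕ) < T
    · simp only [h, dite_true]; fun_prop
    · simp only [h, dite_false]; fun_prop

variable {α c : ℝ} {φ γ : ℕ → ℝ} {Ω : ℕ → Type*} [∀ N, MeasurableSpace (Ω N)]
  {P : (N : ℕ) → Measure (Ω N)} [∀ N, IsProbabilityMeasure (P N)]
  {ζ : (N : ℕ) → Measure (Cube N)} [∀ N, IsProbabilityMeasure (ζ N)]
  {X Z : (N : ℕ) → ℕ → Ω N → Cube N} {ν μ₀ : Measure ℝ} [IsProbabilityMeasure ν]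
  [IsProbabilityMeasure μ₀]

omit [∀ N, IsProbabilityMeasure (ζ N)] in
/-- Replacing the one-step characteristic function of the walk by its limit is asymptotically
harmless when the current scaled norm is tight. -/
lemma tendsto_integral_mul_avgKernel_sub
    (hφ : ∀ N, φ N ∈ Set.Ioo (0 : ℝ) 1) (hγ : ∀ N, γ N ∈ Set.Ioo (0 : ℝ) 1)
    (hsum : ∀ N, 1 ≤ φ N + γ N) (hα : ∀ N, min (φ N) (γ N) = α)
    (hc : Tendsto (fun N : ℕ => √N * (φ N - γ N)) atTop (𝓝 c))
    (hX : ∀ N, IsDrivenWalk (φ N) (γ N) (ζ N) (P N) (X N) (Z N)) (T : ℕ)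
    (htight : ∀ δ > 0, ∃ M : ℝ, ∀ N, (P N).real {ω | M < |scaledNorm (φ N) (X N T ω)|} ≤ δ)
    {f : (N : ℕ) → Ω N → ℂ} {C : ℝ} (hC : ∀ N ω, ‖f N ω‖ ≤ C) (s : ℝ) :
    Tendsto (fun N => ∫ ω, f N ω * (avgKernel (φ N) (γ N) s (X N T ω) (Z N (T + 1) ω) -
      limKernel α c s (scaledNorm (φ N) (X N T ω)) ((hammingNorm01 (Z N (T + 1) ω) : ℝ) / N)) ∂P N)
      atTop (𝓝 0) := by
  have hC0 : 0 ≤ C := by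
    obtain ⟨ω⟩ : Nonempty (Ω 0) := (P 0).nonempty_of_neZero
    exact (norm_nonneg _).trans (hC 0 ω)
  rw [Metric.tendsto_nhds]
  intro ε hε
  -- The kernel difference costs Cδ on the tight set and at most 2Cδ off it, together 3Cδ < ε.
  set δ := ε / (4 * (C + 1)) with hδ
  have hδ0 : 0 < δ := by positivity
  obtain ⟨M, hM⟩ := htight δ hδ0
  filter_upwards [eventually_norm_avgKernel_sub_limKernel_le hφ hγ hsum hα hc s M hδ0] with N hN
  rw [dist_zero_right]
  set A : Set (Ω N) := {ω | M < |scaledNorm (φ N) (X N T ω)|} with hA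
  have hAm : MeasurableSet A := measurableSet_lt measurable_const
    ((Measurable.of_discrete (f := fun x : Cube N => |scaledNorm (φ N) x|)).comp
      ((hX N).measurable_X T))
  have hbound : ∀ ω, ‖f N ω * (avgKernel (φ N) (γ N) s (X N T ω) (Z N (T + 1) ω) -
      limKernel α c s (scaledNorm (φ N) (X N T ω)) ((hammingNorm01 (Z N (T + 1) ω) : ℝ) / N))‖ ≤
      C * δ + A.indicator (fun _ => C * 2) ω := by
    intro ω
    rw [norm_mul]
    by_cases hω : ω ∈ A
    · rw [Set.indicator_of_mem hω]
      have h1 := norm_sub_le (avgKernel (φ N) (γ N) s (X N T ω) (Z N (T + 1) ω))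
        (limKernel α c s (scaledNorm (φ N) (X N T ω)) ((hammingNorm01 (Z N (T + 1) ω) : ℝ) / N))
      have h2 := norm_avgKernel_le_one (hφ N) (hγ N) (hsum N) s (X N T ω) (Z N (T + 1) ω)
      have h3 := norm_limKernel_le_one α c s (scaledNorm (φ N) (X N T ω))
        ((hammingNorm01 (Z N (T + 1) ω) : ℝ) / N)
      calc _ ≤ C * 2 := mul_le_mul (hC N ω) (by linarith) (norm_nonneg _) hC0
        _ ≤ _ := le_add_of_nonneg_left (by positivity)
    · rw [Set.indicator_of_notMem hω, add_zero]
      exact mul_le_mul (hC N ω) (hN _ _ (not_lt.1 hω)) (norm_nonneg _) hC0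
  refine (norm_integral_le_of_norm_le
    ((integrable_const _).add ((integrable_const _).indicator hAm)) (ae_of_all _ hbound)).trans_lt ?_
  have hi : ∫ ω, (C * δ + A.indicator (fun _ => C * 2) ω) ∂P N = C * δ + (P N).real A * (C * 2) := by
    rw [integral_add (integrable_const _) ((integrable_const _).indicator hAm),
      integral_indicator hAm, setIntegral_const]
    simp
  have hi' : ∫ ω, ((fun _ : Ω N => C * δ) + A.indicator (fun _ => C * 2)) ω ∂P N =
      C * δ + (P N).real A * (C * 2) := hi
  have h4 : (P N).real A * (C * 2) ≤ δ * (C * 2) := by gcongr; exact hM N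
  have h5 : δ * (4 * (C + 1)) = ε := by rw [hδ]; field_simp
  rw [hi']
  nlinarith

/-- One step of the induction on the length of the path. -/
lemma tendstoInDistribution_scaledPath_step
    (hφ : ∀ N, φ N ∈ Set.Ioo (0 : ℝ) 1) (hγ : ∀ N, γ N ∈ Set.Ioo (0 : ℝ) 1)
    (hsum : ∀ N, 1 ≤ φ N + γ N) (hα : ∀ N, min (φ N) (γ N) = α)
    (hc : Tendsto (fun N : ℕ => √N * (φ N - γ N)) atTop (𝓝 c))
    (hζ : ∀ N, IsExchangeable (ζ N))
    (hX : ∀ N, IsDrivenWalk (φ N) (γ N) (ζ N) (P N) (X N) (Z N))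
    (T : ℕ) (hZ : TendstoInDistribution
      (fun N ω => (hammingNorm01 (Z N (T + 1) ω) : ℝ) / N) atTop (id : ℝ → ℝ) P ν)
    (ih : TendstoInDistribution (fun N ω => scaledPath (φ N) T (walkPath (X N) (Z N) T ω)) atTop
      (limitPath α c T) P (limitMeasure ν μ₀)) :
    TendstoInDistribution (fun N ω => ((scaledPath (φ N) T (walkPath (X N) (Z N) T ω),
        (hammingNorm01 (Z N (T + 1) ω) : ℝ) / N), scaledNorm (φ N) (X N (T + 1) ω))) atTop
      (fun ω => ((limitPath α c T ω, limitTheta (T + 1) ω), limitV α c (T + 1) ω)) P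
      (limitMeasure ν μ₀) := by
  have hΘ : TendstoInDistribution (fun N ω => (hammingNorm01 (Z N (T + 1) ω) : ℝ) / N) atTop
      (limitTheta (T + 1)) P (limitMeasure ν μ₀) :=
    hZ.congr_law (by fun_prop) ((limitMeasure_map_limitTheta _).trans Measure.map_id.symm)
  have hmU : ∀ N, Measurable fun ω => (scaledPath (φ N) T (walkPath (X N) (Z N) T ω),
      (hammingNorm01 (Z N (T + 1) ω) : ℝ) / N) := fun N =>
    ((Measurable.of_discrete (f := scaledPath (φ N) T)).comp
      ((hX N).measurable_walkPath T)).prodMk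
    ((Measurable.of_discrete (f := fun z : Cube N => (hammingNorm01 z : ℝ) / N)).comp
      ((hX N).measurable_Z (T + 1)))
  have hmV : ∀ N, Measurable fun ω => scaledNorm (φ N) (X N (T + 1) ω) := fun N =>
    (Measurable.of_discrete (f := fun x : Cube N => scaledNorm (φ N) x)).comp
      ((hX N).measurable_X (T + 1))
  -- The new driving vector is independent of the past, and so is the new coefficient in the limit;
  -- marginal convergence therefore gives joint convergence.
  have hU := ih.prodMk_of_indepFun hΘ
    (fun N => ((hX N).indepFun (hφ N) (hγ N) (hsum N) T).comp
      (Measurable.of_discrete (f := scaledPath (φ N) T))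
      (Measurable.of_discrete (f := fun z : Cube N => (hammingNorm01 z : ℝ) / N)))
    (indepFun_limitPath_limitTheta T)
  have hVT : TendstoInDistribution (fun N ω => scaledNorm (φ N) (X N T ω)) atTop (limitV α c T) P
      (limitMeasure ν μ₀) :=
    ih.continuous_comp (g := fun w : (Fin (T + 1) → ℝ) × (Fin T → ℝ) => w.1 (Fin.last T))
      (by fun_prop)
  refine TendstoInDistribution.prodMk_of_forall_integral hmU
    (U' := fun ω => (limitPath α c T ω, limitTheta (T + 1) ω)) (by fun_prop) hmV
    (measurable_limitV α c (T + 1)) (μ := P) (μ' := limitMeasure ν μ₀) fun f s => ?_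
  -- On both sides the exponential of the new value is replaced by its conditional characteristic
  -- function. The limit kernel is a continuous function of the variables already known to converge
  -- jointly.
  rw [integral_limitPath_mul_exp T f.continuous.measurable f.norm_coe_le_norm s]
  have hstep : ∀ N, ∫ ω, f (scaledPath (φ N) T (walkPath (X N) (Z N) T ω),
      (hammingNorm01 (Z N (T + 1) ω) : ℝ) / N) *
        Complex.exp (s * scaledNorm (φ N) (X N (T + 1) ω) * Complex.I) ∂P N =
      ∫ ω, f (scaledPath (φ N) T (walkPath (X N) (Z N) T ω),
        (hammingNorm01 (Z N (T + 1) ω) : ℝ) / N) *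
          avgKernel (φ N) (γ N) s (X N T ω) (Z N (T + 1) ω) ∂P N := fun N =>
    (hX N).integral_mul_exp (hζ N) (hφ N) (hγ N) (hsum N) T s fun u n =>
      f (scaledPath (φ N) T u, (n : ℝ) / N)
  have hlk : Continuous fun u : ((Fin (T + 1) → ℝ) × (Fin T → ℝ)) × ℝ =>
      limKernel α c s (u.1.1 (Fin.last T)) u.2 :=
    continuous_limKernel α c s (by fun_prop) (by fun_prop)
  simp_rw [hstep]
  have hmK : ∀ N, Measurable fun ω => avgKernel (φ N) (γ N) s (X N T ω) (Z N (T + 1) ω) := fun N =>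
    measurable_comp_two_of_finite ((hX N).measurable_X T) ((hX N).measurable_Z (T + 1)) _
  have hdiff := tendsto_integral_mul_avgKernel_sub hφ hγ hsum hα hc hX T
    (fun δ hδ => hVT.exists_forall_measureReal_abs_gt_le hδ)
    (f := fun N ω => f (scaledPath (φ N) T (walkPath (X N) (Z N) T ω),
      (hammingNorm01 (Z N (T + 1) ω) : ℝ) / N)) (fun N ω => f.norm_coe_le_norm _) s
  exact hU.tendsto_integral_mul hmU f hmK
    (fun N ω => norm_avgKernel_le_one (hφ N) (hγ N) (hsum N) s _ _) hlk
    (fun u => norm_limKernel_le_one _ _ _ _ _) hdiff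

/-- Convergence of the finite-dimensional distributions of the walk. -/
theorem tendstoInDistribution_scaledPath
    (hφ : ∀ N, φ N ∈ Set.Ioo (0 : ℝ) 1) (hγ : ∀ N, γ N ∈ Set.Ioo (0 : ℝ) 1)
    (hsum : ∀ N, 1 ≤ φ N + γ N) (hα : ∀ N, min (φ N) (γ N) = α)
    (hc : Tendsto (fun N : ℕ => √N * (φ N - γ N)) atTop (𝓝 c))
    (hζ : ∀ N, IsExchangeable (ζ N))
    (hX : ∀ N, IsDrivenWalk (φ N) (γ N) (ζ N) (P N) (X N) (Z N))
    (hZ : ∀ t, TendstoInDistribution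
      (fun N ω => (hammingNorm01 (Z N (t + 1) ω) : ℝ) / N) atTop (id : ℝ → ℝ) P ν)
    (hV₀ : TendstoInDistribution (fun N ω => scaledNorm (φ N) (X N 0 ω)) atTop
      (id : ℝ → ℝ) P μ₀) (T : ℕ) :
    TendstoInDistribution (fun N ω => scaledPath (φ N) T (walkPath (X N) (Z N) T ω)) atTop
      (limitPath α c T) P (limitMeasure ν μ₀) := by
  induction T with
  | zero =>
    have h0 : TendstoInDistribution (fun N ω => scaledNorm (φ N) (X N 0 ω)) atTop (limitV α c 0)
        P (limitMeasure ν μ₀) :=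
      hV₀.congr_law (by fun_prop) (limitMeasure_map_fst.trans Measure.map_id.symm)
    have h1 := h0.continuous_comp (F := (Fin (0 + 1) → ℝ) × (Fin 0 → ℝ))
      (g := fun v => (fun _ => v, fun _ => 0)) (by fun_prop)
    have e1 : (fun v : ℝ => ((fun _ => v, fun _ => 0) : (Fin (0 + 1) → ℝ) × (Fin 0 → ℝ))) ∘
        limitV α c 0 = limitPath α c 0 := by
      funext ω
      exact Prod.ext (funext fun t => by simp [limitPath]) (Subsingleton.elim _ _)
    have e2 : (fun N => (fun v : ℝ => ((fun _ => v, fun _ => 0) :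
        (Fin (0 + 1) → ℝ) × (Fin 0 → ℝ))) ∘ fun ω => scaledNorm (φ N) (X N 0 ω)) =
        fun N ω => scaledPath (φ N) 0 (walkPath (X N) (Z N) 0 ω) := by
      funext N ω
      exact Prod.ext (funext fun t => by simp [scaledPath, walkPath]) (Subsingleton.elim _ _)
    rw [e1, e2] at h1
    exact h1
  | succ T ih =>
    have hfin := (tendstoInDistribution_scaledPath_step hφ hγ hsum hα hc hζ hX T (hZ T) ih).continuous_comp
      (continuous_appendPath T)
    have e1 : appendPath T ∘ (fun ω => ((limitPath α c T ω, limitTheta (T + 1) ω),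
        limitV α c (T + 1) ω)) = limitPath α c (T + 1) := by
      funext ω
      refine Prod.ext (funext fun t => ?_) (funext fun t => ?_)
      · simp only [appendPath, limitPath, Function.comp]
        split_ifs with h
        · rfl
        · rw [show (t : ℕ) = T + 1 by omega]
      · simp only [appendPath, limitPath, Function.comp]
        split_ifs with h
        · rfl
        · rw [show (t : ℕ) = T by omega]
    have e2 : (fun N => appendPath T ∘ fun ω => ((scaledPath (φ N) T (walkPath (X N) (Z N) T ω),
        (hammingNorm01 (Z N (T + 1) ω) : ℝ) / N), scaledNorm (φ N) (X N (T + 1) ω))) =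
        fun N ω => scaledPath (φ N) (T + 1) (walkPath (X N) (Z N) (T + 1) ω) := by
      funext N ω
      refine Prod.ext (funext fun t => ?_) (funext fun t => ?_)
      · simp only [appendPath, scaledPath, walkPath, Function.comp]
        split_ifs with h
        · rfl
        · rw [show (t : ℕ) = T + 1 by omega]
      · simp only [appendPath, scaledPath, walkPath, Function.comp]
        split_ifs with h
        · rfl
        · rw [show (t : ℕ) = T by omega]
    rw [e1, e2] at hfin
    exact hfin

end Convergence

/-! ### Constant coefficient and stationary laws -/

section Stationary

variable {α c θ : ℝ} {μ₀ : Measure ℝ} [IsProbabilityMeasure μ₀]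

lemma ae_limitTheta_eq (θ : ℝ) (t : ℕ) :
    ∀ᵐ ω ∂limitMeasure (Measure.dirac θ) μ₀, limitTheta t ω = θ := by
  have h : ∀ᵐ x ∂(limitMeasure (Measure.dirac θ) μ₀).map (limitTheta t), x = θ := by
    rw [limitMeasure_map_limitTheta]
    exact (ae_dirac_iff (measurableSet_singleton θ)).2 rfl
  exact ae_of_ae_map (by fun_prop) h

lemma limitMeasure_dirac_map_limitEps (t : ℕ) :
    (limitMeasure (Measure.dirac θ) μ₀).map (limitEps α t) =
      gaussianReal 0 (innovVar α θ).toNNReal := by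
  have h : limitEps α t =ᵐ[limitMeasure (Measure.dirac θ) μ₀]
      (fun x => √(innovVar α θ) * x) ∘ limitXi t := by
    filter_upwards [ae_limitTheta_eq θ t] with ω hω
    simp [limitEps, hω]
  rw [Measure.map_congr h, ← Measure.map_map (by fun_prop) (by fun_prop), limitMeasure_map_limitXi,
    gaussianReal_map_const_mul, ← sqrt_sq_toNNReal]
  congr 1
  · ring
  · rw [mul_one]; exact (Real.toNNReal_of_nonneg (sq_nonneg _)).symm

/-- With Θ = θ fixed the kernel splits into a character of V_t at frequency (1 - θ/α)s and a
deterministic Gaussian factor, so the laws obey a closed recursion. -/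
lemma charFun_map_limitV_succ (t : ℕ) (s : ℝ) :
    charFun ((limitMeasure (Measure.dirac θ) μ₀).map (limitV α c (t + 1))) s =
      charFun ((limitMeasure (Measure.dirac θ) μ₀).map (limitV α c t)) ((1 - θ / α) * s) *
        Complex.exp (((s * ((1 - θ / α) * c) : ℝ) : ℂ) * Complex.I -
          ((s ^ 2 / 2 * (innovVar α θ).toNNReal : ℝ) : ℂ)) := by
  have h := integral_limitPath_mul_exp (α := α) (c := c) (ν := Measure.dirac θ) (μ₀ := μ₀) t
    (f := fun _ => 1) measurable_const (C := 1) (by simp) s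
  simp only [one_mul] at h
  have hm : ∀ (r : ℝ) (ρ : Measure ℝ),
      AEStronglyMeasurable (fun x : ℝ => Complex.exp (r * x * Complex.I)) ρ := fun r ρ => by
    fun_prop
  rw [charFun_apply_real, charFun_apply_real, integral_map (by fun_prop) (hm _ _), h,
    integral_map (by fun_prop) (hm _ _), ← integral_mul_const]
  refine integral_congr_ae ?_
  filter_upwards [ae_limitTheta_eq θ (t + 1)] with ω hω
  rw [hω, limKernel, ← Complex.exp_add]
  congr 1
  push_cast
  ring

lemma charFun_stationary (hα0 : α ≠ 0) (hα : 0 ≤ α * (1 - α)) (hθ : θ ≠ 0)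
    (hvar : 0 ≤ innovVar α θ) (s : ℝ) :
    charFun (gaussianReal (α * c * (1 - θ / α) / θ) (α * (1 - α)).toNNReal) s =
      charFun (gaussianReal (α * c * (1 - θ / α) / θ) (α * (1 - α)).toNNReal) ((1 - θ / α) * s) *
        Complex.exp (((s * ((1 - θ / α) * c) : ℝ) : ℂ) * Complex.I -
          ((s ^ 2 / 2 * (innovVar α θ).toNNReal : ℝ) : ℂ)) := by
  set m := α * c * (1 - θ / α) / θ with hm
  -- The stationary mean is the fixed point of the drift v ↦ (1 - θ/α)(v + c).
  have h1 : m = (1 - θ / α) * (m + c) := by rw [hm]; field_simp; ring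
  have e : ∀ (r : ℝ), charFun (gaussianReal m (α * (1 - α)).toNNReal) r =
      Complex.exp (((r * m : ℝ) : ℂ) * Complex.I - ((α * (1 - α) * r ^ 2 / 2 : ℝ) : ℂ)) := by
    intro r
    rw [charFun_gaussianReal]
    congr 1
    have : (((α * (1 - α)).toNNReal : ℝ) : ℂ) = ((α * (1 - α) : ℝ) : ℂ) := by
      rw [Real.coe_toNNReal _ hα]
    rw [this]
    push_cast
    ring
  rw [e, e, ← Complex.exp_add, Real.coe_toNNReal _ hvar]
  congr 1
  have h2 : s * m = (1 - θ / α) * s * m + s * ((1 - θ / α) * c) := by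
    linear_combination s * h1
  have h3 : α * (1 - α) * s ^ 2 / 2 =
      α * (1 - α) * ((1 - θ / α) * s) ^ 2 / 2 + s ^ 2 / 2 * innovVar α θ := by
    unfold innovVar; ring
  rw [h2, h3]
  push_cast
  ring

lemma map_limitV_eq_of_stationary (hα0 : α ≠ 0) (hα : 0 ≤ α * (1 - α)) (hθ : θ ≠ 0)
    (hvar : 0 ≤ innovVar α θ)
    (hμ₀ : μ₀ = gaussianReal (α * c * (1 - θ / α) / θ) (α * (1 - α)).toNNReal) (t : ℕ) :
    (limitMeasure (Measure.dirac θ) μ₀).map (limitV α c t) = μ₀ := by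
  induction t with
  | zero => exact limitMeasure_map_fst
  | succ t ih =>
    have := Measure.isProbabilityMeasure_map (μ := limitMeasure (Measure.dirac θ) μ₀)
      (measurable_limitV α c (t + 1)).aemeasurable
    refine Measure.ext_of_charFun (funext fun s => ?_)
    rw [charFun_map_limitV_succ, ih]
    conv_rhs => rw [hμ₀, charFun_stationary hα0 hα hθ hvar, ← hμ₀]

/-- The stationary law and the Gaussian satisfy the same recursion, so the quotient of their
characteristic functions takes equal values at s and ρ s. Iterating with |ρ| < 1 carries s to 0,
where the quotient is 1. The Gaussian never vanishes, so the quotient is continuous. -/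
lemma eq_gaussianReal_of_stationary (hα0 : 0 < α) (hα : 0 ≤ α * (1 - α)) (hθ : 0 < θ)
    (hθ2 : θ < 2 * α) (hvar : 0 ≤ innovVar α θ)
    (h : ∀ t, (limitMeasure (Measure.dirac θ) μ₀).map (limitV α c t) = μ₀) :
    μ₀ = gaussianReal (α * c * (1 - θ / α) / θ) (α * (1 - α)).toNNReal := by
  set G := gaussianReal (α * c * (1 - θ / α) / θ) (α * (1 - α)).toNNReal with hG
  set ρ := 1 - θ / α with hρ
  have hρ1 : |ρ| < 1 := by
    have h1 : 0 < θ / α := by positivity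
    have h2 : θ / α < 2 := by rwa [div_lt_iff₀ hα0]
    exact abs_lt.2 ⟨by linarith, by linarith⟩
  have hGne : ∀ s, charFun G s ≠ 0 := fun s => by
    rw [hG, charFun_gaussianReal]; exact Complex.exp_ne_zero _
  have hrec : ∀ s, charFun μ₀ s / charFun G s = charFun μ₀ (ρ * s) / charFun G (ρ * s) := by
    intro s
    have h1 := charFun_map_limitV_succ (α := α) (c := c) (θ := θ) (μ₀ := μ₀) 0 s
    rw [h, h] at h1
    rw [h1, charFun_stationary hα0.ne' hα hθ.ne' hvar s,
      mul_div_mul_right _ _ (Complex.exp_ne_zero _)]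
  have hiter : ∀ (n : ℕ) s,
      charFun μ₀ s / charFun G s = charFun μ₀ (ρ ^ n * s) / charFun G (ρ ^ n * s) := by
    intro n
    induction n with
    | zero => intro s; simp
    | succ n ih =>
      intro s
      rw [hrec s, ih (ρ * s)]
      congr 2 <;> ring
  refine Measure.ext_of_charFun (funext fun s => ?_)
  have hcont : Continuous fun r => charFun μ₀ r / charFun G r :=
    Continuous.div (by fun_prop) (by fun_prop) hGne
  have hlim : Tendsto (fun n : ℕ => ρ ^ n * s) atTop (𝓝 0) := by
    have := (tendsto_pow_atTop_nhds_zero_of_abs_lt_one hρ1).mul_const s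
    rwa [zero_mul] at this
  have h2 : Tendsto (fun _ : ℕ => charFun μ₀ s / charFun G s) atTop
      (𝓝 (charFun μ₀ 0 / charFun G 0)) :=
    ((hcont.tendsto 0).comp hlim).congr fun n => (hiter n s).symm
  have h3 := tendsto_nhds_unique tendsto_const_nhds h2
  rw [charFun_zero, charFun_zero, probReal_univ, probReal_univ, Complex.ofReal_one, div_one] at h3
  exact (div_eq_one_iff_eq (hGne s)).1 h3

end Stationary

/-! ### The main theorem -/

theorem mainTheorem3
    -- parameters
    (α c : ℝ) (φ γ : ℕ → ℝ)
    (hφ : ∀ N, φ N ∈ Set.Ioo (0 : ℝ) 1) (hγ : ∀ N, γ N ∈ Set.Ioo (0 : ℝ) 1)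
    (hsum : ∀ N, 1 ≤ φ N + γ N)
    (hα : ∀ N, min (φ N) (γ N) = α)
    (hc : Tendsto (fun N : ℕ => Real.sqrt N * (φ N - γ N)) atTop (𝓝 c))
    -- the walks, with exchangeable time-homogeneous driving variables
    {Ω : ℕ → Type*} [∀ N, MeasurableSpace (Ω N)]
    (P : (N : ℕ) → Measure (Ω N)) [∀ N, IsProbabilityMeasure (P N)]
    (ζ : (N : ℕ) → Measure (Cube N)) [∀ N, IsProbabilityMeasure (ζ N)]
    (hζ : ∀ N, IsExchangeable (ζ N))
    (X Z : (N : ℕ) → ℕ → Ω N → Cube N)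
    (hX : ∀ N, IsDrivenWalk (φ N) (γ N) (ζ N) (P N) (X N) (Z N))
    -- `‖Z_t‖ / N` converges in distribution to a law `ν` on `[0,1]`
    (ν : Measure ℝ) [IsProbabilityMeasure ν] (hν : ∀ᵐ θ ∂ν, θ ∈ Set.Icc (0 : ℝ) 1)
    (hZ : ∀ t, TendstoInDistribution
      (fun N ω => (hammingNorm01 (Z N (t + 1) ω) : ℝ) / N) atTop (id : ℝ → ℝ) P ν)
    -- `V_0` converges in distribution to a law `μ₀`
    (μ₀ : Measure ℝ) [IsProbabilityMeasure μ₀]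
    (hV₀ : TendstoInDistribution
      (fun N ω => ((hammingNorm01 (X N 0 ω) : ℝ) - N * φ N) / Real.sqrt N) atTop
      (id : ℝ → ℝ) P μ₀) :
    ∃ (Ω' : Type) (_ : MeasurableSpace Ω') (P' : Measure Ω') (_ : IsProbabilityMeasure P')
      (V Θ ε : ℕ → Ω' → ℝ),
      -- the limit process is a normal AR(1) series with random coefficients
      IsRandomCoefAR1 α c ν μ₀ P' V Θ ε ∧
      -- joint convergence of all finite-dimensional distributions
      (∀ T : ℕ, TendstoInDistribution
        (fun N ω =>
          ((fun t : Fin (T + 1) =>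
              ((hammingNorm01 (X N t ω) : ℝ) - N * φ N) / Real.sqrt N),
            (fun t : Fin T => (hammingNorm01 (Z N (t + 1) ω) : ℝ) / N)))
        atTop
        (fun ω => ((fun t : Fin (T + 1) => V t ω), (fun t : Fin T => Θ (t + 1) ω)))
        P P') ∧
      -- conditional law of `V_t` given `V_{t-1} = v` and `Θ_t = θ`
      (∀ t, ∀ᵐ q ∂(P'.map fun ω => (V t ω, Θ (t + 1) ω)),
        condDistrib (V (t + 1)) (fun ω => (V t ω, Θ (t + 1) ω)) P' q =
          gaussianReal ((1 - q.2 / α) * (q.1 + c))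
            (α * (1 - α) * (1 - (1 - q.2 / α) ^ 2)).toNNReal) ∧
      -- `ε_t` (together with `Θ_t`) is independent of `V_{t-1}`
      (∀ t, IndepFun (fun ω => (Θ (t + 1) ω, ε (t + 1) ω)) (V t) P') ∧
      -- constant `Θ_t = θ`: a normal AR(1) series and its stationary law
      (∀ θ : ℝ, ν = Measure.dirac θ →
        (∀ᵐ ω ∂P', ∀ t, V (t + 1) ω = (1 - θ / α) * (c + V t ω) + ε (t + 1) ω) ∧
        (∀ t, P'.map (ε (t + 1)) =
          gaussianReal 0 (α * (1 - α) * (1 - (1 - θ / α) ^ 2)).toNNReal) ∧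
        (0 < θ →
          (μ₀ = gaussianReal (α * c * (1 - θ / α) / θ) (α * (1 - α)).toNNReal →
            ∀ t, P'.map (V t) = μ₀) ∧
          (θ < 2 * α → (∀ t, P'.map (V t) = μ₀) →
            μ₀ = gaussianReal (α * c * (1 - θ / α) / θ) (α * (1 - α)).toNNReal))) := by
  have hα2 := half_le_of_params hsum hα hc
  have hα0 : 0 < α := by linarith
  have hα1 : α < 1 := (hα 0 ▸ min_le_left _ _ : α ≤ φ 0).trans_lt (hφ 0).2
  refine ⟨LimitSpace, inferInstance, limitMeasure ν μ₀, inferInstance, limitV α c, limitTheta,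
    limitEps α, isRandomCoefAR1_limit,
    fun T => tendstoInDistribution_scaledPath hφ hγ hsum hα hc hζ hX hZ hV₀ T,
    condDistrib_limitV, indepFun_limitTheta_limitEps_limitV, ?_⟩
  rintro θ rfl
  have hθ : θ ∈ Set.Icc (0 : ℝ) 1 := (ae_dirac_iff measurableSet_Icc).1 hν
  have hvar : 0 ≤ innovVar α θ := by
    -- From α ≥ 1/2 and θ ≤ 1; hence |1 - θ/α| ≤ 1 and `toNNReal` does not truncate the variance.
    have h1 : θ / α ≤ 2 := by rw [div_le_iff₀ hα0]; linarith [hθ.2]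
    have h2 := div_nonneg hθ.1 hα0.le
    have h3 : 0 ≤ 1 - (1 - θ / α) ^ 2 := by nlinarith
    exact mul_nonneg (mul_nonneg hα0.le (by linarith)) h3
  have hα' : 0 ≤ α * (1 - α) := mul_nonneg hα0.le (by linarith)
  refine ⟨ae_all_iff.2 fun t => ?_, fun t => limitMeasure_dirac_map_limitEps (t + 1),
    fun hθ0 => ⟨map_limitV_eq_of_stationary hα0.ne' hα' hθ0.ne' hvar,
      fun hθ2 => eq_gaussianReal_of_stationary hα0 hα' hθ0 hθ2 hvar⟩⟩
  filter_upwards [ae_limitTheta_eq θ (t + 1)] with ω hω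
  rw [limitV, hω]
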